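/- For a topological space $X$ let $F(X,2)=\{(x,y)\in X\times X : x\neq y\}$, with the subspace topology of $X\times X$, and let $H_*$ and $H^*$ denote singular homology and cohomology with integral coefficients. Let $\Gamma\subset\mathbf R^2$ be a connected planar graph, that is, a subset of the plane (with the subspace topology) that is homeomorphic to the geometric realization of a connected finite simplicial complex of dimension one. Assume that $\Gamma$ has an essential vertex, i.e. a vertex of this complex that is incident to at least three edges. Then the map $$\beta: F(\Gamma,2)\to F(\mathbf R^2,2)\times\Gamma\times\Gamma,\qquad (x,y)\mapsto((x,y),x,y),$$ induces an epimorphism $$\beta_*: H_1(F(\Gamma,2))\to H_1(F(\mathbf R^2,2)\times\Gamma\times\Gamma)$$ and a monomorphism $$\beta^*: H^1(F(\mathbf R^2,2)\times\Gamma\times\Gamma)\to H^1(F(\Gamma,2)).$$ -/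

import Mathlib

open CategoryTheory

/-! ### Integral singular homology and cohomology -/

/-- The singular chain complex of `X` with integral coefficients. -/
noncomputable abbrev singularChains (X : Type) [TopologicalSpace X] :
    ChainComplex (ModuleCat.{0} ℤ) ℕ :=
  ((AlgebraicTopology.singularChainComplexFunctor (ModuleCat.{0} ℤ)).obj (ModuleCat.of ℤ ℤ)).obj
    (TopCat.of X)

/-- The chain map induced on singular chains by a continuous map. -/
noncomputable abbrev singularChainsMap {X Y : Type} [TopologicalSpace X] [TopologicalSpace Y]
    (f : C(X, Y)) : singularChains X ⟶ singularChains Y :=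
  ((AlgebraicTopology.singularChainComplexFunctor (ModuleCat.{0} ℤ)).obj (ModuleCat.of ℤ ℤ)).map
    (TopCat.ofHom f)

/-- `H_n(X)`: singular homology with integral coefficients. -/
noncomputable abbrev singularH (n : ℕ) (X : Type) [TopologicalSpace X] : ModuleCat.{0} ℤ :=
  ((AlgebraicTopology.singularHomologyFunctor (ModuleCat.{0} ℤ) n).obj (ModuleCat.of ℤ ℤ)).obj
    (TopCat.of X)

/-- `f_* : H_n(X) → H_n(Y)`. -/
noncomputable abbrev singularHMap (n : ℕ) {X Y : Type} [TopologicalSpace X] [TopologicalSpace Y]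
    (f : C(X, Y)) : singularH n X ⟶ singularH n Y :=
  ((AlgebraicTopology.singularHomologyFunctor (ModuleCat.{0} ℤ) n).obj (ModuleCat.of ℤ ℤ)).map
    (TopCat.ofHom f)

/-- The singular cochain complex `Hom(C_*(X), ℤ)`. -/
noncomputable abbrev singularCochains (X : Type) [TopologicalSpace X] :
    CochainComplex (ModuleCat.{0} ℤ) ℕ :=
  (singularChains X).linearYonedaObj ℤ (ModuleCat.of ℤ ℤ)

/-- The cochain map `Hom(C_*(Y), ℤ) → Hom(C_*(X), ℤ)`, `φ ↦ φ ∘ f_*`, induced by `f : X → Y`. -/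
noncomputable def singularCochainsMap {X Y : Type} [TopologicalSpace X] [TopologicalSpace Y]
    (f : C(X, Y)) : singularCochains Y ⟶ singularCochains X where
  f i := ModuleCat.ofHom (Linear.leftComp ℤ (ModuleCat.of ℤ ℤ) ((singularChainsMap f).f i))
  comm' i j _ := by
    simp only [ChainComplex.linearYonedaObj_d]
    ext φ : 2
    exact ((singularChainsMap f).comm_assoc j i φ).symm

/-- `H^n(X)`: singular cohomology with integral coefficients. -/
noncomputable abbrev singularCoh (n : ℕ) (X : Type) [TopologicalSpace X] : ModuleCat.{0} ℤ :=
  (singularCochains X).homology n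

/-- `f^* : H^n(Y) → H^n(X)`. -/
noncomputable abbrev singularCohMap (n : ℕ) {X Y : Type} [TopologicalSpace X] [TopologicalSpace Y]
    (f : C(X, Y)) : singularCoh n Y ⟶ singularCoh n X :=
  HomologicalComplex.homologyMap (singularCochainsMap f) n

/-! ### Graphs as topological spaces -/

/-- The geometric realization, in barycentric coordinates, of a finite graph regarded as a
simplicial complex of dimension at most one: its points are the convex combinations of vertices
that are supported on a single vertex or on the two ends of an edge. -/
def SimpleGraph.realization {V : Type*} [Fintype V] (G : SimpleGraph V) : Set (V → ℝ) :=
  {x | x ∈ stdSimplex ℝ V ∧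
    ((∃ v, ∀ w, x w ≠ 0 → w = v) ∨ ∃ u v, G.Adj u v ∧ ∀ w, x w ≠ 0 → w = u ∨ w = v)}

/-! ### Configuration spaces of two points -/

/-- `F(X, 2)`: ordered pairs of distinct points of `X`, with the subspace topology of `X × X`. -/
abbrev Conf2 (X : Type*) : Type _ := {p : X × X // p.1 ≠ p.2}

/-- For `Γ ⊆ ℝ²`, the map `β : F(Γ, 2) → F(ℝ², 2) × Γ × Γ`, `(x, y) ↦ ((x, y), x, y)`. -/
def confBeta (Γ : Set (EuclideanSpace ℝ (Fin 2))) :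
    C(Conf2 Γ, Conf2 (EuclideanSpace ℝ (Fin 2)) × Γ × Γ) where
  toFun p := (⟨(p.1.1, p.1.2), fun h => p.2 (Subtype.ext h)⟩, p.1.1, p.1.2)
  continuous_toFun := by fun_prop

/-! Both claims follow from a single one: for every abelian group `A`, an `A`-valued 1-cocycle on
the target of `confBeta Γ` whose pullback is a coboundary is itself a coboundary
(`surjective_and_injective_of_isExact`). For `A = ℤ` this gives injectivity on H¹. For `A` the
1-chains of the target modulo boundaries and images of cycles, it gives surjectivity on H₁. Only the
values of a cocycle on paths matter, hence `PathCocycle`.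

The target is a product of path connected spaces, so up to a coboundary a cocycle is a sum of
pullbacks φ₁, φ₂, φ₃ from the three factors (`sub_slices_isExact`). Suppose this sum becomes exact
on F(Γ, 2). At the essential vertex Γ contains a triod, on which two points can exchange places
twice along a closed loop of six moves. Each point runs through each arm as often outwards as
inwards, so φ₂ and φ₃ contribute nothing. In F(ℝ², 2) the loop makes exactly one full turn, so φ₁
vanishes on a generator of H₁ and is exact (`IsDiscTriod.isExact`). Freezing one point at `y` then
makes φ₂ exact on Γ ∖ {y}, for every `y`. A cycle of Γ misses some edge at the essential vertex;
with `y` the midpoint of that edge, φ₂ vanishes on the cycle. Hence φ₂ is exact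
(`isExact_of_forall_point`), and φ₃ likewise. -/

open scoped unitInterval

/-! ### Path cocycles: homotopy squares, subdivision, local exactness. -/

/-- The affine path from `a` to `b` in the plane. -/
def affineSeg (a b : ℝ × ℝ) : C(I, ℝ × ℝ) where
  toFun t := ((1 - (t : ℝ)) * a.1 + t * b.1, (1 - (t : ℝ)) * a.2 + t * b.2)
  continuous_toFun := by fun_prop

/-- An `A`-valued function on paths, additive over the edges of every singular triangle: the
restriction to paths of a singular `1`-cocycle. -/
structure PathCocycle (X : Type*) [TopologicalSpace X] (A : Type*) [AddCommGroup A] where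
  toFun : C(I, X) → A
  triangle' : ∀ (f : C(ℝ × ℝ, X)) (a b c : ℝ × ℝ),
    toFun (f.comp (affineSeg a b)) + toFun (f.comp (affineSeg b c)) = toFun (f.comp (affineSeg a c))

namespace PathCocycle

variable {X Y : Type*} [TopologicalSpace X] [TopologicalSpace Y]
  {A : Type*} [AddCommGroup A]

instance : CoeFun (PathCocycle X A) (fun _ => C(I, X) → A) := ⟨toFun⟩

lemma triangle (φ : PathCocycle X A) (f : C(ℝ × ℝ, X)) (a b c : ℝ × ℝ) :
    φ (f.comp (affineSeg a b)) + φ (f.comp (affineSeg b c)) = φ (f.comp (affineSeg a c)) := φ.triangle' f a b c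

/-- A path cocycle is exact if it is the coboundary of a function on points. -/
def IsExact (φ : PathCocycle X A) : Prop :=
  ∃ u : X → A, ∀ p : C(I, X), φ p = u (p 1) - u (p 0)

/-- Pullback along a continuous map. -/
def comap (φ : PathCocycle Y A) (g : C(X, Y)) : PathCocycle X A where
  toFun p := φ (g.comp p)
  triangle' f a b c := φ.triangle (g.comp f) a b c

@[simp] lemma comap_apply (φ : PathCocycle Y A) (g : C(X, Y)) (p : C(I, X)) :
    φ.comap g p = φ (g.comp p) := rfl

instance : Add (PathCocycle X A) where
  add φ ψ := ⟨fun p => φ p + ψ p, fun f a b c => by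
    rw [← φ.triangle f a b c, ← ψ.triangle f a b c]; abel⟩

instance : Sub (PathCocycle X A) where
  sub φ ψ := ⟨fun p => φ p - ψ p, fun f a b c => by
    rw [← φ.triangle f a b c, ← ψ.triangle f a b c]; abel⟩

@[simp] lemma add_apply (φ ψ : PathCocycle X A) (p : C(I, X)) : (φ + ψ) p = φ p + ψ p := rfl

@[simp] lemma sub_apply (φ ψ : PathCocycle X A) (p : C(I, X)) : (φ - ψ) p = φ p - ψ p := rfl

lemma IsExact.add {φ ψ : PathCocycle X A} (hφ : φ.IsExact) (hψ : ψ.IsExact) :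
    (φ + ψ).IsExact := by
  obtain ⟨u, hu⟩ := hφ
  obtain ⟨v, hv⟩ := hψ
  exact ⟨fun x => u x + v x, fun p => by rw [add_apply, hu, hv]; beta_reduce; abel⟩

lemma IsExact.sub {φ ψ : PathCocycle X A} (hφ : φ.IsExact) (hψ : ψ.IsExact) :
    (φ - ψ).IsExact := by
  obtain ⟨u, hu⟩ := hφ
  obtain ⟨v, hv⟩ := hψ
  exact ⟨fun x => u x - v x, fun p => by rw [sub_apply, hu, hv]; beta_reduce; abel⟩

lemma IsExact.comap {φ : PathCocycle Y A} (hφ : φ.IsExact) (g : C(X, Y)) :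
    (φ.comap g).IsExact := by
  obtain ⟨u, hu⟩ := hφ
  exact ⟨fun x => u (g x), fun p => hu _⟩

@[simp] lemma apply_const (φ : PathCocycle X A) (x : X) : φ (ContinuousMap.const I x) = 0 := by
  have h := φ.triangle (ContinuousMap.const _ x) 0 0 0
  have e : (ContinuousMap.const (ℝ × ℝ) x).comp (affineSeg 0 0) = ContinuousMap.const I x := rfl
  rw [e] at h
  simpa using h

/-- A square in `X`, extended to the plane by retraction. -/
noncomputable def extendSquare (H : C(I × I, X)) : C(ℝ × ℝ, X) where
  toFun z := H (Set.projIcc 0 1 zero_le_one z.1, Set.projIcc 0 1 zero_le_one z.2)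
  continuous_toFun := by
    have := continuous_projIcc (a := (0 : ℝ)) (b := 1) (h := zero_le_one)
    fun_prop

lemma extendSquare_affineSeg (H : C(I × I, X)) (a b : ℝ × ℝ) (p : C(I, X))
    (h : ∀ t : I, p t = H (Set.projIcc 0 1 zero_le_one (affineSeg a b t).1,
      Set.projIcc 0 1 zero_le_one (affineSeg a b t).2)) : (extendSquare H).comp (affineSeg a b) = p := by
  ext t
  exact (h t).symm

lemma diag_eq (φ : PathCocycle X A) (H : C(I × I, X)) (d p q : C(I, X))
    (hd : ∀ t, d t = H (t, t)) (hp : ∀ t, p t = H (t, 0)) (hq : ∀ t, q t = H (1, t)) :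
    φ d = φ p + φ q := by
  have h := φ.triangle (extendSquare H) (0, 0) (1, 0) (1, 1)
  rw [extendSquare_affineSeg H _ _ p, extendSquare_affineSeg H _ _ q, extendSquare_affineSeg H _ _ d] at h
  · exact h.symm
  all_goals intro t; simp [affineSeg, hp, hd, hq]

lemma diag_eq' (φ : PathCocycle X A) (H : C(I × I, X)) (d p q : C(I, X))
    (hd : ∀ t, d t = H (t, t)) (hp : ∀ t, p t = H (0, t)) (hq : ∀ t, q t = H (t, 1)) :
    φ d = φ p + φ q :=
  φ.diag_eq (H.comp ⟨Prod.swap, continuous_swap⟩) d p q hd hp hq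

lemma square (φ : PathCocycle X A) (H : C(I × I, X)) (b r l t : C(I, X))
    (hb : ∀ s, b s = H (s, 0)) (hr : ∀ s, r s = H (1, s)) (hl : ∀ s, l s = H (0, s))
    (ht : ∀ s, t s = H (s, 1)) : φ b + φ r = φ l + φ t := by
  rw [← φ.diag_eq H ⟨fun s => H (s, s), by fun_prop⟩ b r (fun _ => rfl) hb hr,
    ← φ.diag_eq' H ⟨fun s => H (s, s), by fun_prop⟩ l t (fun _ => rfl) hl ht]

/-- The part of a path between two parameters. -/
noncomputable def subpath (p : C(I, X)) (a b : ℝ) : C(I, X) where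
  toFun t := p (Set.projIcc 0 1 zero_le_one ((1 - (t : ℝ)) * a + t * b))
  continuous_toFun := by
    have := continuous_projIcc (a := (0 : ℝ)) (b := 1) (h := zero_le_one)
    fun_prop

/-- A degenerate triangle, with its three vertices on one line, makes cocycles additive under
subdivision. -/
lemma subpath_add (φ : PathCocycle X A) (p : C(I, X)) (a b c : ℝ) :
    φ (subpath p a b) + φ (subpath p b c) = φ (subpath p a c) :=
  φ.triangle (extendSquare (p.comp ⟨Prod.fst, continuous_fst⟩)) (a, 0) (b, 0) (c, 0)

/-- A cocycle that is locally the coboundary of a fixed function is its coboundary. -/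
theorem isExact_of_locally {ι : Type*} (φ : PathCocycle X A) (u : X → A) (U : ι → Set X)
    (hU : ∀ i, IsOpen (U i)) (hcov : ∀ x, ∃ i, x ∈ U i)
    (h : ∀ i (p : C(I, X)), (∀ t, p t ∈ U i) → φ p = u (p 1) - u (p 0)) : φ.IsExact := by
  refine ⟨u, fun p => ?_⟩
  -- Lebesgue subdivision: each piece of `p` lies in one `U i`, and the increments of `u` telescope.
  obtain ⟨t, h0, hmono, ⟨n, hn⟩, ht⟩ := exists_monotone_Icc_subset_open_cover_unitInterval
    (c := fun i => p ⁻¹' U i) (fun i => (hU i).preimage p.continuous)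
    (fun s _ => by simpa using hcov (p s))
  have key : ∀ m, φ (subpath p 0 (t m)) = u (p (t m)) - u (p 0) := by
    intro m
    induction m with
    | zero =>
      have : subpath p 0 (t 0) = ContinuousMap.const I (p 0) := by
        ext s; simp [subpath, h0]
      rw [this, h0]; simp
    | succ m ih =>
      obtain ⟨i, hi⟩ := ht m
      have hm : (t m : ℝ) ≤ t (m + 1) := hmono (Nat.le_succ m)
      rw [← φ.subpath_add p 0 (t m) (t (m + 1)), ih, h i]
      · simp [subpath]
      · intro s
        refine hi ?_
        have h1 := s.2.1
        have h2 := s.2.2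
        have e : (1 - (s : ℝ)) * t m + s * t (m + 1) ∈ Set.Icc (t m : ℝ) (t (m + 1)) := by
          constructor <;> nlinarith
        have e' : (1 - (s : ℝ)) * t m + s * t (m + 1) ∈ Set.Icc (0 : ℝ) 1 :=
          ⟨(t m).2.1.trans e.1, e.2.trans (t (m + 1)).2.2⟩
        rw [Set.projIcc_of_mem _ e']
        exact e
  have := key n
  rw [hn n le_rfl] at this
  convert this using 2
  ext s
  simp [subpath]

/-! ### Degree-one Künneth decomposition. -/

section Product

/-- Slice of a path cocycle on a product at a point of the second factor. -/
abbrev sliceLeft (φ : PathCocycle (X × Y) A) (y : Y) : PathCocycle X A :=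
  φ.comap ((ContinuousMap.id X).prodMk (ContinuousMap.const X y))

/-- Slice of a path cocycle on a product at a point of the first factor. -/
abbrev sliceRight (φ : PathCocycle (X × Y) A) (x : X) : PathCocycle Y A :=
  φ.comap ((ContinuousMap.const Y x).prodMk (ContinuousMap.id Y))

lemma prod_eq (φ : PathCocycle (X × Y) A) (p : C(I, X × Y)) :
    φ p = φ.sliceLeft (p 0).2 (ContinuousMap.fst.comp p) +
      φ.sliceRight (p 1).1 (ContinuousMap.snd.comp p) :=
  φ.diag_eq ((ContinuousMap.fst.comp p).prodMap (ContinuousMap.snd.comp p)) _ _ _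
    (fun _ => rfl) (fun _ => rfl) (fun _ => rfl)

lemma slice_square (φ : PathCocycle (X × Y) A) (p : C(I, X)) (q : C(I, Y)) :
    φ.sliceLeft (q 0) p + φ.sliceRight (p 1) q = φ.sliceRight (p 0) q + φ.sliceLeft (q 1) p :=
  φ.square (p.prodMap q) _ _ _ _
    (fun _ => rfl) (fun _ => rfl) (fun _ => rfl) (fun _ => rfl)

lemma exists_path [PathConnectedSpace X] (x y : X) : ∃ p : C(I, X), p 0 = x ∧ p 1 = y := by
  obtain ⟨p⟩ := PathConnectedSpace.joined x y
  exact ⟨p, p.source, p.target⟩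

/-- The square `p × q` shows that moving the slice along `p` changes it by the coboundary of `y ↦ φ
(p × y)`. -/
lemma sliceRight_isExact [PathConnectedSpace X] (φ : PathCocycle (X × Y) A) (x₀ x : X)
    (h : (φ.sliceRight x₀).IsExact) : (φ.sliceRight x).IsExact := by
  obtain ⟨u, hu⟩ := h
  obtain ⟨p, h0, h1⟩ := exists_path x₀ x
  refine ⟨fun y => u y + φ.sliceLeft y p, fun q => ?_⟩
  have := φ.slice_square p q
  rw [h0, h1, hu] at this
  rw [eq_sub_of_add_eq' this]; beta_reduce; abel

theorem isExact_of_slices [PathConnectedSpace X] [PathConnectedSpace Y]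
    (φ : PathCocycle (X × Y) A) (x₀ : X) (y₀ : Y) (hl : (φ.sliceLeft y₀).IsExact)
    (hr : (φ.sliceRight x₀).IsExact) : φ.IsExact := by
  obtain ⟨u, hu⟩ := hl
  choose v hv using fun x => φ.sliceRight_isExact x₀ x hr
  choose η h0 h1 using fun y => exists_path y₀ y
  -- The potential at `(x, y)` integrates from the base point to `(x, y₀)`, then along `{x} × η y`.
  refine ⟨fun z => u z.1 + φ.sliceRight z.1 (η z.2), fun p => ?_⟩
  have e1 := φ.slice_square (ContinuousMap.fst.comp p) (η (p 0).2)
  rw [h0, h1, hu] at e1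
  rw [prod_eq, eq_sub_of_add_eq' e1.symm]
  simp only [hv, h0, h1]
  change u (p 1).1 - u (p 0).1 + (v (p 1).1 (p 0).2 - v (p 1).1 y₀) -
    (v (p 0).1 (p 0).2 - v (p 0).1 y₀) + (v (p 1).1 (p 1).2 - v (p 1).1 (p 0).2) = _
  abel

/-- On a product of path connected spaces, a path cocycle is cohomologous to the sum of the
pullbacks of its slices. -/
theorem sub_slices_isExact [PathConnectedSpace X] [PathConnectedSpace Y]
    (φ : PathCocycle (X × Y) A) (x₀ : X) (y₀ : Y) :
    (φ - ((φ.sliceLeft y₀).comap ContinuousMap.fst +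
      (φ.sliceRight x₀).comap ContinuousMap.snd)).IsExact := by
  -- On each slice through the base point one projection is constant, so the difference vanishes
  -- there.
  refine isExact_of_slices _ x₀ y₀ ⟨0, fun p => ?_⟩ ⟨0, fun p => ?_⟩
  · have h := φ.apply_const (x₀, y₀)
    simp only [comap_apply, sub_apply, add_apply, Pi.zero_apply, sub_zero]
    rw [sub_eq_zero]
    exact (add_eq_left.2 h).symm
  · have h := φ.apply_const (x₀, y₀)
    simp only [comap_apply, sub_apply, add_apply, Pi.zero_apply, sub_zero]
    rw [sub_eq_zero]
    exact (add_eq_right.2 h).symm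

end Product

/-- On a star-shaped region of a subset of a topological vector space, a path cocycle is the
coboundary of its values on the segments from the centre. -/
lemma exists_of_starConvex {E : Type*} [AddCommGroup E] [Module ℝ E] [TopologicalSpace E]
    [ContinuousAdd E] [ContinuousSMul ℝ E] {R S : Set E} (φ : PathCocycle R A) {c : E}
    (hSR : S ⊆ R) (hS : StarConvex ℝ c S) (hc : c ∈ S) :
    ∃ u : R → A, ∀ p : C(I, R), (∀ t, (p t : E) ∈ S) → φ p = u (p 1) - u (p 0) := by
  have mem : ∀ x ∈ S, ∀ t : I, (1 - (t : ℝ)) • c + (t : ℝ) • x ∈ S := fun x hx t =>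
    hS hx (by linarith [t.2.2]) t.2.1 (by ring)
  let s : ∀ x : R, (x : E) ∈ S → C(I, R) := fun x hx =>
    ⟨fun t => ⟨_, hSR (mem x hx t)⟩, by fun_prop⟩
  classical
  refine ⟨fun x => if hx : (x : E) ∈ S then φ (s x hx) else 0, fun p hp => ?_⟩
  -- The cone over `p` with apex `c`: the side at the apex is constant and contributes nothing.
  have h := φ.square
    ⟨fun z : I × I => ⟨_, hSR (mem (p z.2) (hp z.2) z.1)⟩, by fun_prop⟩
    (s (p 0) (hp 0)) p (ContinuousMap.const I ⟨c, hSR hc⟩) (s (p 1) (hp 1))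
    (fun _ => rfl) (fun t => by simp) (fun t => by simp) (fun _ => rfl)
  simp only [dif_pos (hp 0), dif_pos (hp 1)]
  rw [apply_const, zero_add] at h
  rw [← h]; abel

end PathCocycle

/-! ### Singular chains in degrees at most two, on basis elements. -/

namespace SingularChains

open Simplicial

variable {X Y : Type} [TopologicalSpace X] [TopologicalSpace Y]

/-- The singular simplicial set of `X`. -/
noncomputable abbrev sing (X : Type) [TopologicalSpace X] : SSet.{0} :=
  TopCat.toSSet.obj (TopCat.of X)

/-- The singular simplex given by a continuous map from the standard simplex. -/
noncomputable def simplex {n : ℕ} (f : C(stdSimplex ℝ (Fin (n + 1)), X)) : sing X _⦋n⦌ :=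
  ((TopCat.of X).toSSetObjEquiv (.op ⦋n⦌)).symm f

lemma exists_simplex_eq {n : ℕ} (s : sing X _⦋n⦌) : ∃ f, simplex f = s :=
  ⟨_, Equiv.symm_apply_apply _ s⟩

/-- The basis element of the singular chains given by a simplex. -/
noncomputable def chain {n : ℕ} (f : C(stdSimplex ℝ (Fin (n + 1)), X)) : (singularChains X).X n :=
  ((sing X).ιChainComplex (R := ModuleCat.of ℤ ℤ) (simplex f)).hom (1 : ℤ)

lemma d_chain {n : ℕ} (f : C(stdSimplex ℝ (Fin (n + 1 + 1)), X)) :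
    ((singularChains X).d (n + 1) n).hom (chain f) = ∑ i : Fin (n + 2), (-1 : ℤ) ^ (i : ℕ) •
      chain (f.comp ⟨stdSimplex.map (Fin.succAbove i), stdSimplex.continuous_map _⟩) := by
  have h := congrArg (fun g => g.hom (1 : ℤ))
    ((sing X).ιChainComplex_d (ModuleCat.of ℤ ℤ) (simplex f))
  refine Eq.trans h ?_
  simp only [ModuleCat.hom_sum, LinearMap.sum_apply, ModuleCat.hom_zsmul]
  rfl

lemma map_chain {n : ℕ} (g : C(X, Y)) (f : C(stdSimplex ℝ (Fin (n + 1)), X)) :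
    ((singularChainsMap g).f n).hom (chain f) = chain (g.comp f) :=
  congrArg (fun g => g.hom (1 : ℤ))
    (SSet.ι_chainComplexMap_f _ _ (TopCat.toSSet.map (TopCat.ofHom g)) (ModuleCat.of ℤ ℤ)
      (simplex f))

lemma hom_ext {n : ℕ} {A : Type} [AddCommGroup A] {f g : (singularChains X).X n →ₗ[ℤ] A}
    (h : ∀ s, f (chain s) = g (chain s)) : f = g := by
  have : ModuleCat.ofHom f = ModuleCat.ofHom g := by
    refine SSet.chainComplex_hom_ext (X := sing X) (R := ModuleCat.of ℤ ℤ) fun x => ?_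
    obtain ⟨s, rfl⟩ := exists_simplex_eq x
    refine ModuleCat.hom_ext (LinearMap.ext_ring ?_)
    exact h s
  exact congrArg ModuleCat.Hom.hom this

/-- Chains are a coproduct of copies of ℤ over the simplices; together with `hom_ext` this is
freeness. -/
lemma exists_hom {n : ℕ} {A : Type} [AddCommGroup A]
    (v : C(stdSimplex ℝ (Fin (n + 1)), X) → A) :
    ∃ f : (singularChains X).X n →ₗ[ℤ] A, ∀ s, f (chain s) = v s := by
  let c : Limits.Cofan (fun _ : sing X _⦋n⦌ => ModuleCat.of ℤ ℤ) :=
    Limits.Cofan.mk (ModuleCat.of ℤ A) fun s =>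
      ModuleCat.ofHom (LinearMap.toSpanSingleton ℤ A (v ((TopCat.of X).toSSetObjEquiv _ s)))
  refine ⟨(((sing X).isColimitChainComplexXCofan (ModuleCat.of ℤ ℤ) n).desc c).hom, fun s => ?_⟩
  have h := congrArg (fun g => g.hom (1 : ℤ))
    (((sing X).isColimitChainComplexXCofan (ModuleCat.of ℤ ℤ) n).fac c ⟨simplex s⟩)
  refine Eq.trans h ?_
  change (1 : ℤ) • v _ = v s
  rw [one_smul]
  exact congrArg v (Equiv.apply_symm_apply _ s)

/-- The singular `0`-chain of a point. -/
noncomputable def pointChain (x : X) : (singularChains X).X 0 :=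
  chain (ContinuousMap.const _ x)

/-- The singular `1`-chain of a path. -/
noncomputable def pathChain (p : C(I, X)) : (singularChains X).X 1 :=
  chain (p.comp (toContinuousMap stdSimplexHomeomorphUnitInterval))

lemma chain_one_eq (f : C(stdSimplex ℝ (Fin (1 + 1)), X)) : ∃ p, chain f = pathChain p := by
  refine ⟨f.comp (toContinuousMap stdSimplexHomeomorphUnitInterval.symm),
    congrArg chain (ContinuousMap.ext fun z => ?_)⟩
  exact congrArg f (stdSimplexHomeomorphUnitInterval.symm_apply_apply z).symm

lemma map_pathChain (g : C(X, Y)) (p : C(I, X)) :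
    ((singularChainsMap g).f 1).hom (pathChain p) = pathChain (g.comp p) := map_chain _ _

lemma d_pathChain (p : C(I, X)) : ((singularChains X).d 1 0).hom (pathChain p) =
    pointChain (p 1) - pointChain (p 0) := by
  rw [pathChain, d_chain, Fin.sum_univ_two]
  simp only [Fin.val_zero, pow_zero, one_smul, Fin.val_one, pow_one]
  rw [neg_one_zsmul, ← sub_eq_add_neg]
  -- Face `i` omits vertex `i`, so face `0` is the end of the path and face `1` its start.
  have aux : ∀ (i : Fin 2) (z : stdSimplex ℝ (Fin (0 + 1))), stdSimplexHomeomorphUnitInterval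
      (stdSimplex.map (Fin.succAbove i) z) = if i = 0 then 1 else 0 := by
    intro i z
    obtain rfl : z = stdSimplex.vertex 0 := Subsingleton.elim _ _
    rw [stdSimplex.map_vertex]
    fin_cases i
    · exact stdSimplexHomeomorphUnitInterval_one
    · exact stdSimplexHomeomorphUnitInterval_zero
  congr 1 <;> refine congrArg chain (ContinuousMap.ext fun z => DFunLike.congr_arg p ?_)
  · exact aux 0 z
  · exact aux 1 z

/-- The affine triangle in the plane with given vertices. -/
noncomputable def affineTriangle (a b c : ℝ × ℝ) : C(stdSimplex ℝ (Fin 3), ℝ × ℝ) where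
  toFun z := (z.1 0 * a.1 + z.1 1 * b.1 + z.1 2 * c.1, z.1 0 * a.2 + z.1 1 * b.2 + z.1 2 * c.2)
  continuous_toFun := by
    have (i : Fin 3) : Continuous fun z : stdSimplex ℝ (Fin 3) => z.1 i :=
      (continuous_apply i).comp continuous_subtype_val
    exact (((this 0).mul_const _).add ((this 1).mul_const _) |>.add ((this 2).mul_const _)).prodMk
      (((this 0).mul_const _).add ((this 1).mul_const _) |>.add ((this 2).mul_const _))

lemma d_affineTriangle (f : C(ℝ × ℝ, X)) (a b c : ℝ × ℝ) :
    ((singularChains X).d 2 1).hom (chain (f.comp (affineTriangle a b c))) =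
      pathChain (f.comp (affineSeg b c)) - pathChain (f.comp (affineSeg a c)) +
        pathChain (f.comp (affineSeg a b)) := by
  rw [d_chain, Fin.sum_univ_three]
  have aux : ∀ z : stdSimplex ℝ (Fin 2), z.1 0 = 1 - z.1 1 := fun z => by
    have := z.2.2
    rw [Fin.sum_univ_two] at this
    linarith
  have face : ∀ (i : Fin 3) (a' b' : ℝ × ℝ)
      (_ : ∀ z, affineTriangle a b c (stdSimplex.map (Fin.succAbove i) z) =
        affineSeg a' b' (stdSimplexHomeomorphUnitInterval z)),
      chain ((f.comp (affineTriangle a b c)).comp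
        ⟨stdSimplex.map (Fin.succAbove i), stdSimplex.continuous_map _⟩) =
        pathChain (f.comp (affineSeg a' b')) := fun i a' b' h =>
    congrArg chain (ContinuousMap.ext fun z => congrArg f (h z))
  have mapcoe : ∀ (i j : Fin 3) (z : stdSimplex ℝ (Fin 2)),
      (stdSimplex.map (Fin.succAbove i) z).1 j =
        ∑ k : Fin 2, if Fin.succAbove i k = j then z.1 k else 0 := by
    intro i j z
    change FunOnFinite.linearMap ℝ ℝ (Fin.succAbove i) _ j = _
    rw [FunOnFinite.linearMap_apply_apply, Finset.sum_filter]
    rfl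
  rw [face 0 b c, face 1 a c, face 2 a b]
  · simp [sub_eq_add_neg]
  all_goals
    intro z
    simp only [affineTriangle, affineSeg, ContinuousMap.coe_mk, mapcoe, Fin.sum_univ_two]
    simp [Fin.succAbove, aux z]

end SingularChains

/-! ### Homology of complexes of modules, by elements. -/

namespace HomologicalComplex

variable {R : Type} [Ring R] {ι : Type*} {c : ComplexShape ι}
  {K L : HomologicalComplex (ModuleCat.{0} R) c} {i j k : ι}

lemma exists_cycle (hk : c.next j = k) (z : K.X j) (hz : (K.d j k).hom z = 0) :
    ∃ z' : K.cycles j, (K.iCycles j).hom z' = z := by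
  refine ⟨(K.liftCycles (ModuleCat.ofHom (LinearMap.toSpanSingleton R _ z)) k hk ?_).hom 1, ?_⟩
  · refine ModuleCat.hom_ext (LinearMap.ext_ring ?_)
    simpa using hz
  · have := congrArg (fun g => g.hom (1 : R))
      (K.liftCycles_i (ModuleCat.ofHom (LinearMap.toSpanSingleton R _ z)) k hk (by
        refine ModuleCat.hom_ext (LinearMap.ext_ring ?_)
        simpa using hz))
    rw [ModuleCat.hom_comp] at this
    simpa only [LinearMap.comp_apply, ModuleCat.hom_ofHom, LinearMap.toSpanSingleton_apply, one_smul] using this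

lemma iCycles_injective : Function.Injective (K.iCycles j).hom :=
  (ModuleCat.mono_iff_injective _).1 inferInstance

lemma d_iCycles (z : K.cycles j) : (K.d j k).hom ((K.iCycles j).hom z) = 0 :=
  congrArg (fun g => g.hom z) (K.iCycles_d j k)

lemma exists_homologyπ_eq (x : K.homology j) : ∃ z, (K.homologyπ j).hom z = x :=
  (ModuleCat.epi_iff_surjective _).1 inferInstance x

lemma homologyπ_eq_zero_iff (hi : c.prev j = i) (z : K.cycles j) :
    (K.homologyπ j).hom z = 0 ↔ ∃ w, (K.d i j).hom w = (K.iCycles j).hom z := by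
  have hw (w : K.X i) : (K.iCycles j).hom ((K.toCycles i j).hom w) = (K.d i j).hom w :=
    congrArg (fun g => g.hom w) (K.toCycles_i i j)
  constructor
  · intro h
    obtain ⟨w, rfl⟩ := (ShortComplex.moduleCat_exact_iff _).1
      (ShortComplex.exact_of_g_is_cokernel
        (ShortComplex.mk _ _ (K.toCycles_comp_homologyπ i j)) (K.homologyIsCokernel i j hi)) z h
    exact ⟨w, (hw w).symm⟩
  · rintro ⟨w, h⟩
    obtain rfl : (K.toCycles i j).hom w = z := iCycles_injective ((hw w).trans h)
    exact congrArg (fun g => g.hom w) (K.toCycles_comp_homologyπ i j)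

lemma homologyMap_homologyπ (f : K ⟶ L) (z : K.cycles j) : (homologyMap f j).hom
    ((K.homologyπ j).hom z) = (L.homologyπ j).hom ((cyclesMap f j).hom z) :=
  congrArg (fun g => g.hom z) (homologyπ_naturality f j)

lemma iCycles_cyclesMap (f : K ⟶ L) (z : K.cycles j) : (L.iCycles j).hom
    ((cyclesMap f j).hom z) = (f.f j).hom ((K.iCycles j).hom z) :=
  congrArg (fun g => g.hom z) (cyclesMap_i f j)

lemma homologyMap_surjective (f : K ⟶ L) (hi : c.prev j = i) (hk : c.next j = k)
    (h : ∀ z : L.X j, (L.d j k).hom z = 0 →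
      ∃ w z', (K.d j k).hom z' = 0 ∧ z = (L.d i j).hom w + (f.f j).hom z') :
    Function.Surjective (homologyMap f j) := by
  intro x
  obtain ⟨z, rfl⟩ := exists_homologyπ_eq x
  obtain ⟨w, z', hz', e⟩ := h _ (d_iCycles z)
  obtain ⟨y, rfl⟩ := exists_cycle hk z' hz'
  refine ⟨(K.homologyπ j).hom y, ?_⟩
  refine (homologyMap_homologyπ f y).trans ?_
  rw [← sub_eq_zero, ← map_sub, homologyπ_eq_zero_iff hi]
  refine ⟨-w, ?_⟩
  rw [map_sub, iCycles_cyclesMap, e, map_neg]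
  abel

lemma homologyMap_injective (f : K ⟶ L) (hi : c.prev j = i)
    (h : ∀ z : K.X j, (K.d j k).hom z = 0 → (∃ w, (L.d i j).hom w = (f.f j).hom z) →
      ∃ w, (K.d i j).hom w = z) :
    Function.Injective (homologyMap f j) := by
  refine (injective_iff_map_eq_zero (homologyMap f j).hom).2 fun x hx => ?_
  obtain ⟨z, rfl⟩ := exists_homologyπ_eq x
  rw [homologyMap_homologyπ, homologyπ_eq_zero_iff hi, iCycles_cyclesMap] at hx
  exact (homologyπ_eq_zero_iff hi z).2 (h _ (d_iCycles z) hx)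

end HomologicalComplex

/-! ### From path cocycles to H₁ and H¹. -/

namespace PathCocycle

open SingularChains

variable {X Y : Type} [TopologicalSpace X] [TopologicalSpace Y] {A : Type} [AddCommGroup A]

/-- The path cocycle underlying a singular `1`-cocycle. -/
noncomputable def ofChains (c : (singularChains X).X 1 →ₗ[ℤ] A)
    (hc : ∀ z, c (((singularChains X).d 2 1).hom z) = 0) : PathCocycle X A where
  toFun p := c (pathChain p)
  triangle' f a b d := by
    have h := hc (chain (f.comp (affineTriangle a b d)))
    rw [d_affineTriangle, map_add, map_sub] at h
    rw [← sub_eq_zero, ← h]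
    abel

lemma IsExact.exists_factor {c : (singularChains X).X 1 →ₗ[ℤ] A}
    {hc : ∀ z, c (((singularChains X).d 2 1).hom z) = 0} (h : (ofChains c hc).IsExact) :
    ∃ v : (singularChains X).X 0 →ₗ[ℤ] A, ∀ z, v (((singularChains X).d 1 0).hom z) = c z := by
  obtain ⟨u, hu⟩ := h
  obtain ⟨v, hv⟩ := exists_hom (X := X) (n := 0) (fun s => u (s default))
  have hv' : ∀ x, v (pointChain x) = u x := fun x => hv _
  refine ⟨v, LinearMap.congr_fun (f := v ∘ₗ ((singularChains X).d 1 0).hom) (hom_ext fun s => ?_)⟩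
  obtain ⟨p, hp⟩ := chain_one_eq s
  rw [hp, LinearMap.comp_apply, d_pathChain, map_sub, hv', hv']
  exact (hu p).symm

/-- Choose a base point in each path component and a path `γ x` from it to `x`. Closing `p` up with
`γ (p 0)` and `γ (p 1)` gives a cycle, so `x ↦ c (γ x)` is a potential. -/
lemma isExact_ofChains {c : (singularChains X).X 1 →ₗ[ℤ] A}
    {hc : ∀ z, c (((singularChains X).d 2 1).hom z) = 0}
    (h : ∀ z, ((singularChains X).d 1 0).hom z = 0 → c z = 0) : (ofChains c hc).IsExact := by
  let r : X → X := fun x => Quotient.out (s := pathSetoid X) (Quotient.mk (pathSetoid X) x)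
  have hr (x : X) : Joined (r x) x := Quotient.exact (s := pathSetoid X) (Quotient.out_eq _)
  have hr' (p : C(I, X)) : r (p 0) = r (p 1) :=
    congrArg (Quotient.out (s := pathSetoid X)) (Quotient.sound (s := pathSetoid X) ⟨⟨p, rfl, rfl⟩⟩)
  let γ (x : X) : C(I, X) := (hr x).somePath
  have h0 (x : X) : γ x 0 = r x := (hr x).somePath.source
  have h1 (x : X) : γ x 1 = x := (hr x).somePath.target
  refine ⟨fun x => c (pathChain (γ x)), fun p => ?_⟩
  have key := h (pathChain p + pathChain (γ (p 0)) - pathChain (γ (p 1))) (by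
    simp only [map_add, map_sub, d_pathChain, h0, h1, hr' p]
    abel)
  rw [map_sub, map_add, sub_eq_zero] at key
  exact eq_sub_of_add_eq key

/-- If every path cocycle that becomes exact along `f` is exact, then `f` induces an epimorphism
on `H₁` and a monomorphism on `H¹`. -/
theorem surjective_and_injective_of_isExact (f : C(X, Y))
    (h : ∀ (A : Type) [AddCommGroup A] (φ : PathCocycle Y A), (φ.comap f).IsExact → φ.IsExact) :
    Function.Surjective (singularHMap 1 f) ∧ Function.Injective (singularCohMap 1 f) := by
  constructor
  · refine HomologicalComplex.homologyMap_surjective (singularChainsMap f) (i := 2) (k := 0)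
      (ChainComplex.prev _ 1) (ChainComplex.next_nat_succ 0) fun z hz => ?_
    -- The quotient by `B` is the universal coefficient group: its cocycle `q` kills the images of
    -- cycles of `X`, and once `q` factors through `d`, every cycle of `Y` lies in `B`.
    let B : Submodule ℤ ((singularChains Y).X 1) := LinearMap.range ((singularChains Y).d 2 1).hom ⊔
      (LinearMap.ker ((singularChains X).d 1 0).hom).map ((singularChainsMap f).f 1).hom
    -- Linearity is spelled out to reconcile the ℤ-action of the module with that of its additive
    -- group.
    let q : (singularChains Y).X 1 →ₗ[ℤ] (singularChains Y).X 1 ⧸ B :=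
      { toFun := B.mkQ
        map_add' := map_add B.mkQ
        map_smul' := fun n x => (congrArg B.mkQ (int_smul_eq_zsmul _ n x)).trans
          (map_zsmul B.mkQ.toAddMonoidHom n x) }
    have hB : ∀ z, q (((singularChains Y).d 2 1).hom z) = 0 := fun z =>
      (Submodule.Quotient.mk_eq_zero B).2 (Submodule.mem_sup_left ⟨z, rfl⟩)
    have hX : ∀ z, ((singularChains X).d 1 0).hom z = 0 →
        q (((singularChainsMap f).f 1).hom z) = 0 := fun z hz =>
      (Submodule.Quotient.mk_eq_zero B).2 (Submodule.mem_sup_right ⟨z, hz, rfl⟩)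
    have hcomm : ∀ z, q (((singularChainsMap f).f 1).hom (((singularChains X).d 2 1).hom z)) =
        0 := fun z => hX _ (congrArg (fun g => g.hom z) ((singularChains X).d_comp_d 2 1 0))
    obtain ⟨v, hv⟩ := (h _ (ofChains q hB) (by
      have := isExact_ofChains (c := q ∘ₗ ((singularChainsMap f).f 1).hom) (hc := hcomm) hX
      obtain ⟨u, hu⟩ := this
      refine ⟨u, fun p => Eq.trans ?_ (hu p)⟩
      exact congrArg q (map_pathChain f p).symm)).exists_factor
    have hzB : z ∈ B := (Submodule.Quotient.mk_eq_zero B).1 (by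
      have := hv z
      rw [hz, map_zero] at this
      exact this.symm)
    obtain ⟨_, ⟨w, rfl⟩, _, ⟨z', hz', rfl⟩, e⟩ := Submodule.mem_sup.1 hzB
    exact ⟨w, z', hz', e.symm⟩
  · refine HomologicalComplex.homologyMap_injective (singularCochainsMap f) (i := 0) (k := 2)
      (CochainComplex.prev_nat_succ 0) fun (c : (singularChains Y).X 1 ⟶ ModuleCat.of ℤ ℤ) hc => ?_
    rintro ⟨(w : (singularChains X).X 0 ⟶ ModuleCat.of ℤ ℤ), hw⟩
    have hc' : (singularChains Y).d 2 1 ≫ c = 0 := hc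
    have hw' : (singularChains X).d 1 0 ≫ w = (singularChainsMap f).f 1 ≫ c := hw
    obtain ⟨v, hv⟩ := (h ℤ (ofChains c.hom fun z => congrArg (fun g => g.hom z) hc') (by
      refine ⟨fun x => w.hom (pointChain x), fun p => ?_⟩
      have := congrArg (fun g => g.hom (pathChain p)) hw'
      change w.hom (((singularChains X).d 1 0).hom (pathChain p)) =
        c.hom (((singularChainsMap f).f 1).hom (pathChain p)) at this
      rw [d_pathChain, map_sub, map_pathChain] at this
      exact this.symm)).exists_factor
    refine ⟨(ModuleCat.ofHom v : (singularChains Y).X 0 ⟶ ModuleCat.of ℤ ℤ), ?_⟩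
    exact ModuleCat.hom_ext (LinearMap.ext hv)

end PathCocycle

/-! ### The universal covering of F(ℂ, 2) and the period of a cocycle. -/

namespace PathCocycle

variable {A : Type*} [AddCommGroup A]

theorem isExact_of_vectorSpace {E : Type*} [AddCommGroup E] [Module ℝ E] [TopologicalSpace E]
    [ContinuousAdd E] [ContinuousSMul ℝ E] (φ : PathCocycle E A) : φ.IsExact := by
  obtain ⟨u, hu⟩ := exists_of_starConvex (R := (Set.univ : Set E)) (S := Set.univ) (c := (0 : E))
    (φ.comap ⟨Subtype.val, continuous_subtype_val⟩) le_rfl (starConvex_univ _) trivial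
  exact ⟨fun x => u ⟨x, trivial⟩, fun p =>
    hu ⟨fun t => ⟨p t, trivial⟩, by fun_prop⟩ fun _ => trivial⟩

end PathCocycle

namespace Conf2

/-- A pair of paths that never meet, as a path in the configuration space. -/
def path {X : Type*} [TopologicalSpace X] (x y : C(I, X)) (h : ∀ t, x t ≠ y t) :
    C(I, Conf2 X) where
  toFun t := ⟨(x t, y t), h t⟩
  continuous_toFun := by fun_prop

/-- An injective continuous map induces a map on configuration spaces. -/
def map {X Y : Type*} [TopologicalSpace X] [TopologicalSpace Y] (f : C(X, Y))
    (hf : Function.Injective f) : C(Conf2 X, Conf2 Y) where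
  toFun z := ⟨(f z.1.1, f z.1.2), fun h => z.2 (hf h)⟩
  continuous_toFun := by fun_prop

/-- The universal covering of the configuration space of two points in the complex plane. -/
noncomputable def expCover : C(ℂ × ℂ, Conf2 ℂ) where
  toFun z := ⟨(z.1 + Complex.exp z.2, z.1), by simp [Complex.exp_ne_zero]⟩
  continuous_toFun := by fun_prop

lemma expCover_eq {y w : ℂ} {z : Conf2 ℂ} (hy : y = z.1.2)
    (hw : Complex.exp w = z.1.1 - z.1.2) : expCover (y, w) = z := by
  refine Subtype.ext (Prod.ext ?_ hy)
  change y + Complex.exp w = _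
  rw [hw, hy]; ring

lemma expCover_surjective : Function.Surjective expCover := fun z =>
  ⟨(z.1.2, Complex.log (z.1.1 - z.1.2)),
    expCover_eq rfl (Complex.exp_log (sub_ne_zero.2 z.2))⟩

instance : PathConnectedSpace (Conf2 ℂ) :=
  expCover_surjective.pathConnectedSpace expCover.continuous

/-- The second point is kept, and the difference of the points is lifted through `exp`. -/
lemma exists_lift (p : C(I, Conf2 ℂ)) (w : ℂ) (hw : Complex.exp w = (p 0).1.1 - (p 0).1.2) :
    ∃ q : C(I, ℂ × ℂ), expCover.comp q = p ∧ q 0 = ((p 0).1.2, w) := by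
  obtain ⟨l, hl, h0⟩ := Complex.isCoveringMap_exp.exists_path_lifts
    ⟨fun t => (⟨(p t).1.1 - (p t).1.2, sub_ne_zero.2 (p t).2⟩ : {z : ℂ // z ≠ 0}), by fun_prop⟩ w
    (Subtype.ext hw.symm)
  refine ⟨⟨fun t => ((p t).1.2, l t), by fun_prop⟩, ?_, Prod.ext rfl h0⟩
  ext1 t
  exact expCover_eq rfl (congrArg Subtype.val (congrFun hl t))

open Complex in
/-- A path cocycle on the configuration space of the plane is exact as soon as its value on one
full turn vanishes. -/
theorem isExact_of_period_eq {A : Type*} [AddCommGroup A] (φ : PathCocycle (Conf2 ℂ) A)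
    (U : ℂ × ℂ → A) (hU : ∀ q : C(I, ℂ × ℂ), φ (expCover.comp q) = U (q 1) - U (q 0))
    (y₀ w₀ : ℂ) (h : U (y₀, w₀ + 2 * Real.pi * Complex.I) = U (y₀, w₀)) : φ.IsExact := by
  -- A path `q` and its translate by 2πi have the same image, so `U` grows equally along both: the
  -- period is the same at every point.
  have per : ∀ z : ℂ × ℂ, U (z.1, z.2 + 2 * Real.pi * Complex.I) = U z := by
    intro z
    obtain ⟨q, h0, h1⟩ := PathCocycle.exists_path (y₀, w₀) z
    have e := hU ⟨fun t => ((q t).1, (q t).2 + 2 * Real.pi * Complex.I), by fun_prop⟩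
    have : expCover.comp ⟨fun t => ((q t).1, (q t).2 + 2 * Real.pi * Complex.I), by fun_prop⟩ =
        expCover.comp q := by
      ext1 t
      refine expCover_eq rfl ?_
      simp [expCover, Complex.exp_add]
    rw [this, hU, h0, h1] at e
    simp only [ContinuousMap.coe_mk, h0, h1, h] at e
    exact (sub_left_injective e).symm
  have perZ : ∀ (n : ℤ) (y w : ℂ), U (y, w + n * (2 * Real.pi * Complex.I)) = U (y, w) := by
    intro n y
    induction n with
    | zero => simp
    | succ n ih =>
      intro w
      rw [← ih w, ← per (y, w + (n : ℤ) * (2 * Real.pi * Complex.I))]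
      push_cast
      ring_nf
    | pred n ih =>
      intro w
      rw [← ih w, ← per (y, w + ((-n - 1 : ℤ) : ℂ) * (2 * Real.pi * Complex.I))]
      push_cast
      ring_nf
  -- The jumps of the principal logarithm are multiples of 2πi, which `U` does not see.
  refine ⟨fun z => U (z.1.2, log (z.1.1 - z.1.2)), fun p => ?_⟩
  obtain ⟨q, rfl, h0⟩ := exists_lift p _ (exp_log (sub_ne_zero.2 (p 0).2))
  rw [hU]
  congr 1
  · obtain ⟨n, hn⟩ := exp_eq_exp_iff_exists_int.1
      (show exp (q 1).2 = exp (log ((expCover (q 1)).1.1 - (expCover (q 1)).1.2)) by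
        rw [exp_log (sub_ne_zero.2 (expCover (q 1)).2)]
        simp [expCover])
    have : q 1 = ((q 1).1, log ((expCover (q 1)).1.1 - (expCover (q 1)).1.2) +
      n * (2 * Real.pi * Complex.I)) := Prod.ext rfl hn
    rw [this, perZ]
    rfl
  · rw [h0]

end Conf2

/-! ### The hexagonal loop on a triod in a disc. -/

namespace Conf2

open Complex

/-- A disc lies on one side of its tangent at `p`, touching it only at `p`. Seen from the end of
another arm, an arm thus stays in an open half-plane, where `log` is continuous and angles are below
π/2. -/
lemma div_re_pos {a p : ℂ} (h : ‖a‖ ≤ ‖p‖) (hne : a ≠ p) (hp : p ≠ 0) :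
    0 < ((a - p) / (0 - p)).re := by
  have e : (a - p) / (0 - p) = 1 - a / p := by
    rw [zero_sub]; field_simp; ring
  rw [e, sub_re, one_re, sub_pos]
  have hn : ‖a / p‖ ≤ 1 := by
    rw [norm_div]; exact div_le_one_of_le₀ h (norm_nonneg _)
  refine lt_of_le_of_ne ((re_le_norm _).trans hn) fun h1 => hne ?_
  have him : (a / p).im = 0 := by
    have := sq_norm_sub_sq_re (a / p)
    rw [h1] at this
    nlinarith [norm_nonneg (a / p), sq_nonneg (a / p).im]
  have : a / p = 1 := Complex.ext h1 him
  exact (div_eq_one_iff_eq hp).1 this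

lemma two_mul_eq_of_exp_eq_neg_one {s : ℂ} (h : exp s = -1) (hs : |s.im| < 3 * Real.pi) :
    2 * s = 2 * Real.pi * Complex.I ∨ 2 * s = -(2 * Real.pi * Complex.I) := by
  rw [← exp_pi_mul_I, exp_eq_exp_iff_exists_int] at h
  obtain ⟨n, rfl⟩ := h
  have him : ((Real.pi : ℂ) * Complex.I + n * (2 * Real.pi * Complex.I)).im =
      Real.pi * (1 + 2 * n) := by
    simp; ring
  rw [him, abs_mul, abs_of_pos Real.pi_pos, mul_comm, mul_lt_mul_iff_left₀ Real.pi_pos,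
    abs_lt] at hs
  have h1 : n < 1 := by
    have : (n : ℝ) < 1 := by linarith
    exact_mod_cast this
  have h2 : -2 < n := by
    have : (-2 : ℝ) < n := by linarith
    exact_mod_cast this
  obtain rfl | rfl : n = 0 ∨ n = -1 := by omega
  · left; push_cast; ring
  · right; push_cast; ring

variable {α : Fin 3 → C(I, ℂ)} {o : ℂ} {r : ℝ}

/-- Three paths leaving a common centre that stay in a closed disc around it and end at distinct
points of its boundary, each of which is avoided by the two other paths. -/
structure IsDiscTriod (α : Fin 3 → C(I, ℂ)) (o : ℂ) (r : ℝ) : Prop where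
  pos : 0 < r
  source (i) : α i 0 = o
  norm_le (i t) : ‖α i t - o‖ ≤ r
  norm_target (i) : ‖α i 1 - o‖ = r
  ne (i k t) : i ≠ k → α i t ≠ α k 1

namespace IsDiscTriod

lemma target_ne (h : IsDiscTriod α o r) (k : Fin 3) : o - α k 1 ≠ 0 := fun h0 => by
  have := h.norm_target k
  rw [← sub_eq_zero.1 h0, sub_self, norm_zero] at this
  exact h.pos.ne this

lemma re_pos (h : IsDiscTriod α o r) {i k : Fin 3} (hik : i ≠ k) (t : I) :
    0 < ((α i t - α k 1) / (o - α k 1)).re := by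
  have := div_re_pos (a := α i t - o) (p := α k 1 - o)
    ((h.norm_le i t).trans_eq (h.norm_target k).symm)
    (fun e => h.ne i k t hik (sub_left_injective e))
    (fun e => h.target_ne k (by rw [← neg_sub, e, neg_zero]))
  simpa using this

/-- The logarithmic increment of an arm of a triod as seen from the end of another arm. -/
noncomputable def angle (α : Fin 3 → C(I, ℂ)) (o : ℂ) (i k : Fin 3) : ℂ :=
  log ((α i 1 - α k 1) / (o - α k 1))

lemma exp_angle (h : IsDiscTriod α o r) {i k : Fin 3} (hik : i ≠ k) :
    exp (angle α o i k) = (α i 1 - α k 1) / (o - α k 1) :=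
  exp_log (div_ne_zero (sub_ne_zero.2 (h.ne i k 1 hik)) (h.target_ne k))

lemma abs_im_angle (h : IsDiscTriod α o r) {i k : Fin 3} (hik : i ≠ k) :
    |(angle α o i k).im| < Real.pi / 2 := by
  rw [angle, log_im]
  exact abs_arg_lt_pi_div_two_iff.2 (Or.inl (h.re_pos hik 1))

/-- The first point moves along an arm, the second rests at the end of another arm. -/
noncomputable def moveLeft (h : IsDiscTriod α o r) {i k : Fin 3} (hik : i ≠ k) : C(I, Conf2 ℂ) :=
  path (α i) (ContinuousMap.const I (α k 1)) fun t => h.ne i k t hik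

/-- The second point moves along an arm, the first rests at the end of another arm. -/
noncomputable def moveRight (h : IsDiscTriod α o r) {i k : Fin 3} (hik : i ≠ k) : C(I, Conf2 ℂ) :=
  path (ContinuousMap.const I (α k 1)) (α i) fun t => (h.ne i k t hik).symm

variable {A : Type*} [AddCommGroup A] {φ : PathCocycle (Conf2 ℂ) A} {U : ℂ × ℂ → A}

lemma continuous_angle (h : IsDiscTriod α o r) {i k : Fin 3} (hik : i ≠ k) :
    Continuous fun t => log ((α i t - α k 1) / (o - α k 1)) :=
  Continuous.clog (by fun_prop) fun t => Or.inl (h.re_pos hik t)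

lemma exp_log_angle (h : IsDiscTriod α o r) {i k : Fin 3} (hik : i ≠ k) (t : I) :
    exp (log ((α i t - α k 1) / (o - α k 1))) = (α i t - α k 1) / (o - α k 1) :=
  exp_log (div_ne_zero (sub_ne_zero.2 (h.ne i k t hik)) (h.target_ne k))

/-- The move is lifted explicitly: the logarithm of the difference starts at `w`, since `log 1 = 0`,
and grows by `angle α o i k`. -/
lemma apply_moveLeft (h : IsDiscTriod α o r)
    (hU : ∀ q : C(I, ℂ × ℂ), φ (expCover.comp q) = U (q 1) - U (q 0))
    {i k : Fin 3} (hik : i ≠ k) {w : ℂ} (hw : exp w = o - α k 1) :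
    φ (h.moveLeft hik) = U (α k 1, w + angle α o i k) - U (α k 1, w) := by
  have := hU ⟨fun t => (α k 1, w + log ((α i t - α k 1) / (o - α k 1))),
    continuous_const.prodMk (continuous_const.add (h.continuous_angle hik))⟩
  have e : expCover.comp ⟨fun t => (α k 1, w + log ((α i t - α k 1) / (o - α k 1))),
      continuous_const.prodMk (continuous_const.add (h.continuous_angle hik))⟩ =
      h.moveLeft hik := by
    ext1 t
    refine expCover_eq rfl ?_
    rw [exp_add, hw, h.exp_log_angle hik, mul_div_cancel₀ _ (h.target_ne k)]
    rfl
  rw [e] at this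
  simpa [h.source, div_self (h.target_ne k), angle] using this

lemma apply_moveRight (h : IsDiscTriod α o r)
    (hU : ∀ q : C(I, ℂ × ℂ), φ (expCover.comp q) = U (q 1) - U (q 0))
    {i k : Fin 3} (hik : i ≠ k) {w : ℂ} (hw : exp w = α k 1 - o) :
    φ (h.moveRight hik) = U (α i 1, w + angle α o i k) - U (o, w) := by
  have := hU ⟨fun t => (α i t, w + log ((α i t - α k 1) / (o - α k 1))),
    (α i).continuous.prodMk (continuous_const.add (h.continuous_angle hik))⟩
  have e : expCover.comp ⟨fun t => (α i t, w + log ((α i t - α k 1) / (o - α k 1))),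
      (α i).continuous.prodMk (continuous_const.add (h.continuous_angle hik))⟩ =
      h.moveRight hik := by
    ext1 t
    refine expCover_eq rfl ?_
    rw [exp_add, hw, h.exp_log_angle hik, ← neg_sub, neg_mul, mul_div_cancel₀ _ (h.target_ne k)]
    exact neg_sub _ _
  rw [e] at this
  simpa [h.source, div_self (h.target_ne k), angle] using this

lemma exp_sub_angle (h : IsDiscTriod α o r) {i k : Fin 3} (hik : i ≠ k) {w : ℂ}
    (hw : exp w = α i 1 - α k 1) : exp (w - angle α o i k) = o - α k 1 := by
  rw [exp_sub, hw, h.exp_angle hik]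
  exact div_div_cancel₀ (sub_ne_zero.2 (h.ne i k 1 hik))

lemma exp_sub_angle' (h : IsDiscTriod α o r) {i k : Fin 3} (hik : i ≠ k) {w : ℂ}
    (hw : exp w = α k 1 - α i 1) : exp (w - angle α o i k) = α k 1 - o := by
  rw [exp_sub, hw, h.exp_angle hik, ← neg_sub (α i 1), neg_div,
    div_div_cancel₀ (sub_ne_zero.2 (h.ne i k 1 hik)), neg_sub]

/-- The first point passes from the end of arm `i` through the centre to the end of arm `j`. The
second conjunct supplies the initial logarithm of the next move. -/
lemma sub_moveLeft (h : IsDiscTriod α o r)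
    (hU : ∀ q : C(I, ℂ × ℂ), φ (expCover.comp q) = U (q 1) - U (q 0))
    {i j k : Fin 3} (hik : i ≠ k) (hjk : j ≠ k) {w : ℂ} (hw : exp w = α i 1 - α k 1) :
    φ (h.moveLeft hjk) - φ (h.moveLeft hik) =
        U (α k 1, w - angle α o i k + angle α o j k) - U (α k 1, w) ∧
      exp (w - angle α o i k + angle α o j k) = α j 1 - α k 1 := by
  have hv := h.exp_sub_angle hik hw
  refine ⟨?_, ?_⟩
  · rw [h.apply_moveLeft hU hjk hv, h.apply_moveLeft hU hik hv, sub_add_cancel]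
    abel
  · rw [exp_add, hv, h.exp_angle hjk, mul_div_cancel₀ _ (h.target_ne k)]

lemma sub_moveRight (h : IsDiscTriod α o r)
    (hU : ∀ q : C(I, ℂ × ℂ), φ (expCover.comp q) = U (q 1) - U (q 0))
    {i j k : Fin 3} (hik : i ≠ k) (hjk : j ≠ k) {w : ℂ} (hw : exp w = α k 1 - α i 1) :
    φ (h.moveRight hjk) - φ (h.moveRight hik) =
        U (α j 1, w - angle α o i k + angle α o j k) - U (α i 1, w) ∧
      exp (w - angle α o i k + angle α o j k) = α k 1 - α j 1 := by
  have hv := h.exp_sub_angle' hik hw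
  refine ⟨?_, ?_⟩
  · rw [h.apply_moveRight hU hjk hv, h.apply_moveRight hU hik hv, sub_add_cancel]
    abel
  · rw [exp_add, hv, h.exp_angle hjk, ← neg_sub o, neg_mul, mul_div_cancel₀ _ (h.target_ne k),
      neg_sub]

/-- A path cocycle on the configuration space of the plane is exact if its sum over the hexagonal
loop of the two-point configurations on a triod vanishes. -/
theorem isExact (h : IsDiscTriod α o r) (φ : PathCocycle (Conf2 ℂ) A) (f g a b : Fin 3 → A)
    (e : Fin 3 → Fin 3 → A)
    (hl : ∀ i k (hik : i ≠ k), φ (h.moveLeft hik) + f i = e i k - a k)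
    (hr : ∀ i k (hik : i ≠ k), φ (h.moveRight hik) + g i = e k i - b k) : φ.IsExact := by
  obtain ⟨U, hU⟩ := (φ.comap expCover).isExact_of_vectorSpace
  have h01 : (0 : Fin 3) ≠ 1 := by decide
  have h02 : (0 : Fin 3) ≠ 2 := by decide
  have h12 : (1 : Fin 3) ≠ 2 := by decide
  -- The six moves visit the end pairs 01, 21, 20, 10, 12, 02, 01; each starts at the logarithm
  -- reached by the previous one.
  obtain ⟨e1, w1⟩ := h.sub_moveLeft hU h01 h12.symm
    (exp_log (sub_ne_zero.2 (h.ne 0 1 1 h01)))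
  obtain ⟨e2, w2⟩ := h.sub_moveRight hU h12 h02 w1
  obtain ⟨e3, w3⟩ := h.sub_moveLeft hU h02.symm h01.symm w2
  obtain ⟨e4, w4⟩ := h.sub_moveRight hU h01 h12.symm w3
  obtain ⟨e5, w5⟩ := h.sub_moveLeft hU h12 h02 w4
  obtain ⟨e6, w6⟩ := h.sub_moveRight hU h02.symm h01.symm w5
  set w := log (α 0 1 - α 1 1)
  -- The increment over three moves, which exchange the two points; the other three moves repeat it.
  set s : ℂ := angle α o 2 1 - angle α o 0 1 + (angle α o 0 2 - angle α o 1 2) +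
    (angle α o 1 0 - angle α o 2 0) with hs
  have loop : U (α 1 1, w + 2 * s) = U (α 1 1, w) := by
    have hw : w + 2 * s = w - angle α o 0 1 + angle α o 2 1 - angle α o 1 2 + angle α o 0 2 -
        angle α o 2 0 + angle α o 1 0 - angle α o 0 1 + angle α o 2 1 - angle α o 1 2 +
        angle α o 0 2 - angle α o 2 0 + angle α o 1 0 := by
      rw [hs]; ring
    rw [hw, ← sub_eq_zero]
    rw [eq_sub_of_add_eq (hl _ _ _), eq_sub_of_add_eq (hl _ _ _)] at e1 e3 e5
    rw [eq_sub_of_add_eq (hr _ _ _), eq_sub_of_add_eq (hr _ _ _)] at e2 e4 e6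
    -- In the sum over the hexagon all values of `f`, `g`, `a`, `b` and `e` cancel.
    have := congrArg₂ (· + ·) (congrArg₂ (· + ·) (congrArg₂ (· + ·) e1 e2)
      (congrArg₂ (· + ·) e3 e4)) (congrArg₂ (· + ·) e5 e6)
    beta_reduce at this
    refine Eq.trans ?_ (this.symm.trans ?_) <;> abel
  -- The factors `o - α k 1` cancel, and three differences of ends remain over their negatives.
  have hexp : exp s = -1 := by
    rw [hs]
    simp only [exp_add, exp_sub, h.exp_angle h01, h.exp_angle h01.symm, h.exp_angle h02,
      h.exp_angle h02.symm, h.exp_angle h12, h.exp_angle h12.symm]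
    have n0 := h.target_ne 0
    have n1 := h.target_ne 1
    have n2 := h.target_ne 2
    have d01 := sub_ne_zero.2 (h.ne 0 1 1 h01)
    have d02 := sub_ne_zero.2 (h.ne 0 2 1 h02)
    have d12 := sub_ne_zero.2 (h.ne 1 2 1 h12)
    rw [← neg_sub (α 0 1) (α 1 1), ← neg_sub (α 0 1) (α 2 1), ← neg_sub (α 1 1) (α 2 1)]
    field_simp
  -- Six angles, each below π/2; this excludes any winding number other than ±1.
  have him : |s.im| < 3 * Real.pi := by
    have b1 := abs_lt.1 (h.abs_im_angle h01)
    have b2 := abs_lt.1 (h.abs_im_angle h02)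
    have b3 := abs_lt.1 (h.abs_im_angle h12)
    have b4 := abs_lt.1 (h.abs_im_angle h01.symm)
    have b5 := abs_lt.1 (h.abs_im_angle h02.symm)
    have b6 := abs_lt.1 (h.abs_im_angle h12.symm)
    rw [hs, abs_lt]
    simp only [add_im, sub_im]
    constructor <;> linarith
  rcases two_mul_eq_of_exp_eq_neg_one hexp him with h2 | h2
  · exact isExact_of_period_eq φ U hU (α 1 1) w (h2 ▸ loop)
  · refine isExact_of_period_eq φ U hU (α 1 1) (w + 2 * s) ?_
    rw [loop, h2, neg_add_cancel_right]

end IsDiscTriod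

end Conf2

/-! ### Cutting three arcs down to a triod in a disc. -/

namespace Conf2

lemma exists_first_exit (f : C(I, ℂ)) {r : ℝ} (hr : 0 ≤ r) (h1 : r ≤ ‖f 1 - f 0‖) :
    ∃ τ : I, ‖f τ - f 0‖ = r ∧ ∀ t ≤ τ, ‖f t - f 0‖ ≤ r := by
  have hc : Continuous fun t => ‖f t - f 0‖ := by fun_prop
  obtain ⟨τ, hτ, hmin⟩ := (isClosed_le continuous_const hc).isCompact.exists_isLeast ⟨1, h1⟩
  have lt (t : I) (ht : t < τ) : ‖f t - f 0‖ < r := not_le.1 fun h => (hmin h).not_gt ht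
  have eq : ‖f τ - f 0‖ = r := by
    obtain ⟨t, ht, e⟩ := intermediate_value_Icc (α := I) (bot_le : (0 : I) ≤ τ) hc.continuousOn
      (show r ∈ Set.Icc ‖f 0 - f 0‖ ‖f τ - f 0‖ from ⟨by simpa using hr, hτ⟩)
    rwa [ht.2.antisymm (hmin e.ge)] at e
  exact ⟨τ, eq, fun t ht => ht.lt_or_eq.elim (fun h => (lt t h).le) fun h => h ▸ eq.le⟩

/-- The initial part of a path, up to the parameter `τ`. -/
def initial {X : Type*} [TopologicalSpace X] (f : C(I, X)) (τ : I) : C(I, X) :=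
  ⟨fun t => f (t * τ), by fun_prop⟩

/-- Three arcs in the plane meeting only in their common source contain a triod that is properly
embedded in a disc. -/
lemma exists_isDiscTriod (f : Fin 3 → C(I, ℂ)) (o : ℂ) (h0 : ∀ i, f i 0 = o)
    (h1 : ∀ i, f i 1 ≠ o) (h : ∀ i k s t, i ≠ k → f i s = f k t → t = 0) :
    ∃ (τ : Fin 3 → I) (r : ℝ), IsDiscTriod (fun i => initial (f i) (τ i)) o r := by
  have hpos : ∀ i, 0 < ‖f i 1 - f i 0‖ := fun i => by
    rw [h0, norm_pos_iff, sub_ne_zero]; exact h1 i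
  -- With `r` at most the distance of every end from the centre, each arc reaches the circle.
  obtain ⟨r, hr, hle⟩ : ∃ r : ℝ, 0 < r ∧ ∀ i, r ≤ ‖f i 1 - f i 0‖ := by
    refine ⟨Finset.univ.inf' Finset.univ_nonempty fun i => ‖f i 1 - f i 0‖, ?_, fun i => ?_⟩
    · exact (Finset.lt_inf'_iff _).2 fun i _ => hpos i
    · exact Finset.inf'_le _ (Finset.mem_univ i)
  choose τ hτ hle using fun i => exists_first_exit (f i) hr.le (hle i)
  simp only [h0] at hτ hle
  refine ⟨τ, r, hr, fun i => ?_, fun i t => hle i _ ?_, fun i => ?_, fun i k t hik e => ?_⟩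
  · simp [initial, h0]
  · exact Subtype.coe_le_coe.1 (mul_le_of_le_one_left (τ i).2.1 t.2.2)
  · simpa [initial] using hτ i
  · have := h i k _ _ hik e
    rw [one_mul] at this
    have hk := hτ k
    rw [this, h0, sub_self, norm_zero] at hk
    exact hr.ne hk

end Conf2

/-! ### Potentials on the vertices of a graph. -/

namespace SimpleGraph

variable {V : Type*} {G : SimpleGraph V} {A : Type*} [AddCommGroup A]

/-- The sum of a function of ordered pairs of vertices over the steps of a walk. -/
def Walk.stepSum (e : V → V → A) : ∀ {a b : V}, G.Walk a b → A
  | _, _, .nil => 0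
  | _, _, .cons (u := a) (v := b) _ p => e a b + p.stepSum e

lemma Walk.stepSum_append (e : V → V → A) {a b c : V} (p : G.Walk a b) (q : G.Walk b c) :
    (p.append q).stepSum e = p.stepSum e + q.stepSum e := by
  induction p with
  | nil => simp [stepSum]
  | cons h p ih => simp [stepSum, ih, add_assoc]

lemma Walk.stepSum_eq_of_forall_edge (e : V → V → A) (u : V → A) {a b : V} (p : G.Walk a b)
    (h : ∀ x y, s(x, y) ∈ p.edges → e x y = u y - u x) : p.stepSum e = u b - u a := by
  induction p with
  | nil => simp [stepSum]
  | cons hadj p ih =>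
    rw [stepSum, h _ _ (by simp), ih fun x y hxy => h x y (by simp [hxy])]
    abel

/-- Any other path through the edge joining its ends would return to its first vertex. -/
lemma Walk.eq_cons_nil_of_isPath {a b : V} {p : G.Walk a b} (hp : p.IsPath)
    (h : s(a, b) ∈ p.edges) (hadj : G.Adj a b) : p = Walk.cons hadj .nil := by
  cases p with
  | nil => simp at h
  | cons h' q =>
    rw [Walk.cons_isPath_iff] at hp
    rw [Walk.edges_cons, List.mem_cons] at h
    rcases h with h | h
    · rcases Sym2.eq_iff.1 h with ⟨_, rfl⟩ | ⟨rfl, rfl⟩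
      · obtain rfl := (isPath_iff_nil.1 hp.1).eq_nil
        rfl
      · exact absurd rfl h'.ne
    · exact absurd (q.fst_mem_support_of_mem_edges h) hp.2

-- Each closed piece cut out by `bypass` is either a cycle or an edge run back and forth; both have
-- sum zero.
open Classical in
lemma Walk.stepSum_bypass (e : V → V → A) (he : ∀ a b, G.Adj a b → e b a = -e a b)
    (hc : ∀ a (c : G.Walk a a), c.IsCycle → c.stepSum e = 0) {a b : V} (p : G.Walk a b) :
    p.bypass.stepSum e = p.stepSum e := by
  induction p with
  | nil => rfl
  | @cons u v w h p ih =>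
    rw [bypass, stepSum, ← ih]
    split_ifs with hs
    · have := congrArg (Walk.stepSum e) (p.bypass.take_spec hs)
      rw [stepSum_append] at this
      rw [← this, ← add_assoc, right_eq_add]
      have hp : (p.bypass.takeUntil u hs).IsPath := p.bypass_isPath.takeUntil hs
      by_cases hmem : s(u, v) ∈ (p.bypass.takeUntil u hs).edges
      · rw [eq_cons_nil_of_isPath hp (Sym2.eq_swap ▸ hmem) h.symm]
        simp [stepSum, he _ _ h]
      · exact hc _ (Walk.cons h (p.bypass.takeUntil u hs)) ((cons_isCycle_iff _ _).2 ⟨hp, hmem⟩)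
    · rfl

/-- An antisymmetric function on the oriented edges of a connected graph whose sums over cycles
vanish is the coboundary of a function on the vertices. -/
theorem Connected.exists_potential (hG : G.Connected) (e : V → V → A)
    (he : ∀ a b, G.Adj a b → e b a = -e a b)
    (hc : ∀ a (c : G.Walk a a), c.IsCycle → c.stepSum e = 0) :
    ∃ u : V → A, ∀ a b, G.Adj a b → e a b = u b - u a := by
  classical
  obtain ⟨o⟩ := hG.nonempty
  have closed : ∀ c : G.Walk o o, c.stepSum e = 0 := fun c => by
    rw [← Walk.stepSum_bypass e he hc, (Walk.isPath_iff_nil.1 c.bypass_isPath).eq_nil]; rfl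
  have rev : ∀ {a b : V} (p : G.Walk a b), p.reverse.stepSum e = -p.stepSum e := by
    intro a b p
    induction p with
    | nil => simp [Walk.stepSum]
    | cons h p ih =>
      simp [Walk.stepSum, Walk.stepSum_append, ih, he _ _ h]
  let γ (a : V) : G.Walk o a := (hG.preconnected o a).some
  refine ⟨fun a => (γ a).stepSum e, fun a b h => ?_⟩
  have := closed ((γ a).append (.cons h (γ b).reverse))
  rw [Walk.stepSum_append, Walk.stepSum, rev] at this
  rw [← sub_eq_zero, ← this]
  abel

/-- A cycle uses exactly two edges at each vertex it visits. -/
lemma Walk.IsCycle.exists_adj_notMem_edges [Fintype V] [DecidableRel G.Adj] {a v : V}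
    {c : G.Walk a a} (hc : c.IsCycle) (hv : 3 ≤ G.degree v) :
    ∃ w, G.Adj v w ∧ s(v, w) ∉ c.edges := by
  by_contra! hall
  have hsub : G.neighborSet v ⊆ c.toSubgraph.neighborSet v := fun w hw =>
    (c.adj_toSubgraph_iff_mem_edges).2 (hall w hw)
  obtain ⟨w, hw⟩ : ∃ w, G.Adj v w := by
    obtain ⟨w, hw⟩ := Finset.card_pos.1 ((show 0 < 3 by decide).trans_le hv)
    exact ⟨w, (G.mem_neighborFinset v w).1 hw⟩
  have h2 := hc.ncard_neighborSet_toSubgraph_eq_two (c.fst_mem_support_of_mem_edges (hall w hw))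
  have h3 := Set.ncard_le_ncard hsub (Set.toFinite _)
  rw [h2, Set.ncard_eq_toFinset_card', Set.toFinset_card, card_neighborSet_eq_degree] at h3
  omega

end SimpleGraph

/-! ### Path cocycles on the realization of a graph. -/

namespace SimpleGraph.realization

variable {V : Type*} [Fintype V] {G : SimpleGraph V} {A : Type*} [AddCommGroup A]

/-- The closed edge (or vertex) spanned by two vertices. -/
def edge (a b : V) : Set (V → ℝ) := {x | x ∈ stdSimplex ℝ V ∧ ∀ w, x w ≠ 0 → w = a ∨ w = b}

/-- The open star of a vertex. -/
def star (G : SimpleGraph V) (a : V) : Set (V → ℝ) := {x | x ∈ G.realization ∧ x a ≠ 0}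

lemma edge_subset {a b : V} (h : G.Adj a b) : edge a b ⊆ G.realization :=
  fun _ hx => ⟨hx.1, Or.inr ⟨a, b, h, hx.2⟩⟩

lemma convex_edge (a b : V) : Convex ℝ (edge a b) := by
  intro x hx y hy s t hs ht hst
  refine ⟨convex_stdSimplex ℝ V hx.1 hy.1 hs ht hst, fun w hw => ?_⟩
  by_contra hne
  have h1 : x w = 0 := not_not.1 fun h => hne (hx.2 w h)
  have h2 : y w = 0 := not_not.1 fun h => hne (hy.2 w h)
  exact hw (by simp [h1, h2])

section

variable [DecidableEq V]

lemma single_mem (G : SimpleGraph V) (a : V) : Pi.single a (1 : ℝ) ∈ G.realization :=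
  ⟨single_mem_stdSimplex ℝ a, Or.inl ⟨a, fun _ hw => by
    by_contra h; exact hw (Pi.single_eq_of_ne h _)⟩⟩

/-- A vertex as a point of the realization. -/
def vertex (G : SimpleGraph V) (a : V) : G.realization := ⟨Pi.single a 1, single_mem G a⟩

lemma single_mem_edge_left (a b : V) : Pi.single a (1 : ℝ) ∈ edge a b :=
  ⟨single_mem_stdSimplex ℝ a, fun _ hw => Or.inl (by
    by_contra h; exact hw (Pi.single_eq_of_ne h _))⟩

lemma single_mem_edge_right (a b : V) : Pi.single b (1 : ℝ) ∈ edge a b :=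
  ⟨single_mem_stdSimplex ℝ b, fun _ hw => Or.inr (by
    by_contra h; exact hw (Pi.single_eq_of_ne h _))⟩

lemma single_mem_star (G : SimpleGraph V) (a : V) : Pi.single a (1 : ℝ) ∈ star G a :=
  ⟨single_mem G a, by simp⟩

/-- Moving from `x` towards `a` does not enlarge the support of `x`, which already contains `a`. -/
lemma starConvex_star (a : V) : StarConvex ℝ (Pi.single a 1) (star G a) := by
  intro x hx s t hs ht hst
  have hmem := convex_stdSimplex ℝ V (single_mem_stdSimplex ℝ a) hx.1.1 hs ht hst
  have hxa : 0 < x a := lt_of_le_of_ne (hx.1.1.1 a) hx.2.symm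
  have hsupp : ∀ w, (s • (Pi.single a 1 : V → ℝ) + t • x) w ≠ 0 → x w ≠ 0 := by
    intro w hw h0
    by_cases hwa : w = a
    · exact hx.2 (hwa ▸ h0)
    · exact hw (by simp [h0, Pi.single_eq_of_ne hwa])
  refine ⟨⟨hmem, hx.1.2.imp ?_ ?_⟩, ?_⟩
  · rintro ⟨v, hv⟩
    exact ⟨v, fun w hw => hv w (hsupp w hw)⟩
  · rintro ⟨u, v, huv, hv⟩
    exact ⟨u, v, huv, fun w hw => hv w (hsupp w hw)⟩
  · have : 0 < s + t * x a := by
      rcases hs.lt_or_eq with h | h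
      · positivity
      · rw [← h, zero_add] at hst ⊢
        rw [hst]; simpa using hxa
    simpa using this.ne'

/-- The segment between two adjacent vertices. -/
noncomputable def edgePath {a b : V} (h : G.Adj a b) : C(I, G.realization) where
  toFun t := ⟨(1 - (t : ℝ)) • Pi.single a 1 + (t : ℝ) • Pi.single b 1,
    edge_subset h (convex_edge a b (single_mem_edge_left a b) (single_mem_edge_right a b)
      (by linarith [t.2.2]) t.2.1 (by ring))⟩
  continuous_toFun := by fun_prop

lemma edgePath_mem {a b : V} (h : G.Adj a b) (t : I) : (edgePath h t : V → ℝ) ∈ edge a b :=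
  convex_edge a b (single_mem_edge_left a b) (single_mem_edge_right a b)
    (by linarith [t.2.2]) t.2.1 (by ring)

@[simp] lemma edgePath_zero {a b : V} (h : G.Adj a b) : edgePath h 0 = vertex G a :=
  Subtype.ext (by simp [edgePath, vertex])

@[simp] lemma edgePath_one {a b : V} (h : G.Adj a b) : edgePath h 1 = vertex G b :=
  Subtype.ext (by simp [edgePath, vertex])

/-- The segment from a vertex to a point of its open star. -/
noncomputable def starPath {a : V} (x : G.realization) (h : (x : V → ℝ) a ≠ 0) :
    C(I, G.realization) where
  toFun t := ⟨(1 - (t : ℝ)) • Pi.single a 1 + (t : ℝ) • (x : V → ℝ),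
    (starConvex_star a ⟨x.2, h⟩ (by linarith [t.2.2]) t.2.1 (by ring)).1⟩
  continuous_toFun := by fun_prop

lemma starPath_mem {a : V} (x : G.realization) (h : (x : V → ℝ) a ≠ 0) (t : I) :
    (starPath x h t : V → ℝ) ∈ star G a :=
  starConvex_star a ⟨x.2, h⟩ (by linarith [t.2.2]) t.2.1 (by ring)

@[simp] lemma starPath_zero {a : V} (x : G.realization) (h : (x : V → ℝ) a ≠ 0) :
    starPath x h 0 = vertex G a := Subtype.ext (by simp [starPath, vertex])

@[simp] lemma starPath_one {a : V} (x : G.realization) (h : (x : V → ℝ) a ≠ 0) :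
    starPath x h 1 = x := Subtype.ext (by simp [starPath])

lemma starPath_mem_edge {a b : V} (x : G.realization) (h : (x : V → ℝ) a ≠ 0)
    (hx : (x : V → ℝ) ∈ edge a b) (t : I) : (starPath x h t : V → ℝ) ∈ edge a b :=
  convex_edge a b (single_mem_edge_left a b) hx (by linarith [t.2.2]) t.2.1 (by ring)

end

lemma exists_ne_zero (x : G.realization) : ∃ a, (x : V → ℝ) a ≠ 0 := by
  by_contra! h
  have := x.2.1.2
  simp [h] at this

lemma edge_comm (a b : V) : edge a b = edge b a := by
  ext x; simp [edge, or_comm]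

lemma eq_or_adj (x : G.realization) {a b : V} (ha : (x : V → ℝ) a ≠ 0)
    (hb : (x : V → ℝ) b ≠ 0) : a = b ∨ G.Adj a b ∧ (x : V → ℝ) ∈ edge a b := by
  by_cases hab : a = b
  · exact Or.inl hab
  refine Or.inr ?_
  obtain ⟨hx, ⟨v, hv⟩ | ⟨u, v, huv, hv⟩⟩ := x.2
  · exact absurd ((hv a ha).trans (hv b hb).symm) hab
  · rcases hv a ha with rfl | rfl <;> rcases hv b hb with rfl | rfl
    · exact absurd rfl hab
    · exact ⟨huv, hx, hv⟩
    · exact ⟨huv.symm, hx, fun w hw => (hv w hw).symm⟩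
    · exact absurd rfl hab

theorem pathConnectedSpace (hG : G.Connected) : PathConnectedSpace G.realization := by
  classical
  have hV : ∀ {a b : V}, G.Walk a b → Joined (vertex G a) (vertex G b) := by
    intro a b p
    induction p with
    | nil => exact Joined.refl _
    | cons h p ih => exact Joined.trans ⟨⟨edgePath h, edgePath_zero h, edgePath_one h⟩⟩ ih
  have hx : ∀ x : G.realization, ∃ a, Joined (vertex G a) x := fun x => by
    obtain ⟨a, ha⟩ := exists_ne_zero x
    exact ⟨a, ⟨⟨starPath x ha, starPath_zero x ha, starPath_one x ha⟩⟩⟩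
  obtain ⟨o⟩ := hG.nonempty
  refine ⟨⟨vertex G o⟩, fun x y => ?_⟩
  obtain ⟨a, ha⟩ := hx x
  obtain ⟨b, hb⟩ := hx y
  exact ha.symm.trans ((hV (hG.preconnected a b).some).trans hb)

/-- The midpoint of an edge lies on no other closed edge. -/
lemma exists_midpoint {v w : V} (h : G.Adj v w) :
    ∃ m : G.realization, ∀ a b, (m : V → ℝ) ∈ edge a b → s(v, w) = s(a, b) := by
  classical
  refine ⟨edgePath h ⟨1 / 2, by norm_num, by norm_num⟩, fun a b hm => ?_⟩
  have hv := hm.2 v (by simp [edgePath, Pi.single_eq_of_ne h.ne]; norm_num)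
  have hw := hm.2 w (by simp [edgePath, Pi.single_eq_of_ne h.ne'])
  have := h.ne
  grind

/-- On a connected graph with an essential vertex, a path cocycle is exact if it is exact on the
complement of every point. -/
theorem isExact_of_forall_point [DecidableRel G.Adj] (hG : G.Connected) (hv : ∃ v, 3 ≤ G.degree v)
    (φ : PathCocycle G.realization A)
    (hφ : ∀ y, ∃ u : G.realization → A, ∀ p : C(I, G.realization), (∀ t, p t ≠ y) →
      φ p = u (p 1) - u (p 0)) : φ.IsExact := by
  classical
  obtain ⟨v₀, hv₀⟩ := hv
  choose uE huE using fun (a b : V) (h : G.Adj a b) => φ.exists_of_starConvex (edge_subset h)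
    (convex_edge a b (single_mem_edge_left a b)) (single_mem_edge_left a b)
  choose uS huS using fun a : V => φ.exists_of_starConvex (R := G.realization)
    (fun _ hx => hx.1) (starConvex_star a) (single_mem_star G a)
  let e : V → V → A := fun a b => if h : G.Adj a b then φ (edgePath h) else 0
  have he : ∀ {a b} (h : G.Adj a b), e a b = φ (edgePath h) := fun h => dif_pos h
  obtain ⟨k, hk⟩ := hG.exists_potential e (fun a b h => by
      rw [he h, he h.symm, huE a b h _ (edgePath_mem h),
        huE a b h _ fun t => edge_comm b a ▸ edgePath_mem h.symm t]
      simp) (fun a c hc => by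
      obtain ⟨w, hw, hmem⟩ := hc.exists_adj_notMem_edges hv₀
      obtain ⟨m, hm⟩ := exists_midpoint hw
      obtain ⟨u, hu⟩ := hφ m
      -- The cycle avoids the midpoint `m` of an unused edge, so the potential off `m` telescopes
      -- along it.
      rw [c.stepSum_eq_of_forall_edge e (fun a => u (vertex G a)), sub_self]
      intro x y hxy
      have hadj := c.adj_of_mem_edges hxy
      rw [he hadj, hu _ fun t ht => hmem (hm x y (ht ▸ edgePath_mem hadj t) ▸ hxy)]
      simp)
  choose i hi using exists_ne_zero (G := G)
  -- Reach `x` from a chosen vertex of its support; `hu` shows that any other vertex of the support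
  -- gives the same value, by exactness on their common closed edge.
  let u : G.realization → A := fun x => k (i x) + φ (starPath x (hi x))
  have hu : ∀ a (x : G.realization) (hx : (x : V → ℝ) a ≠ 0), u x = k a + uS a x - uS a (vertex G a) := by
    intro a x hx
    have key : ∀ b (hb : (x : V → ℝ) b ≠ 0),
        φ (starPath x hb) = uS b x - uS b (vertex G b) := fun b hb => by
      rw [huS b _ (starPath_mem x hb), starPath_one, starPath_zero]
    have : k (i x) + φ (starPath x (hi x)) = k a + φ (starPath x hx) := by
      rcases eq_or_adj x hx (hi x) with h | ⟨h, hmem⟩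
      · subst h; rfl
      · have h1 := huE _ _ h _ (starPath_mem_edge x hx hmem)
        have h2 := huE _ _ h _ fun t =>
          edge_comm _ a ▸ starPath_mem_edge x (hi x) (edge_comm a _ ▸ hmem) t
        have h3 := huE _ _ h _ (edgePath_mem h)
        rw [← he h, hk _ _ h] at h3
        simp only [starPath_one, starPath_zero, edgePath_one, edgePath_zero] at h1 h2 h3
        rw [h1, h2, eq_add_of_sub_eq h3]
        abel
    rw [add_sub_assoc, ← key a hx]
    exact this
  refine φ.isExact_of_locally u (fun a => {x | (x : V → ℝ) a ≠ 0})
    (fun a => isOpen_ne.preimage ((continuous_apply a).comp continuous_subtype_val))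
    exists_ne_zero fun a p hp => ?_
  rw [huS a p fun t => ⟨(p t).2, hp t⟩, hu a _ (hp 1), hu a _ (hp 0)]
  abel

end SimpleGraph.realization

/-! ### Planar graphs: the triod at the essential vertex and the comparison along `confBeta`. -/

lemma SimpleGraph.exists_three_neighbors {V : Type*} [Fintype V] (G : SimpleGraph V)
    [DecidableRel G.Adj] {v : V} (hv : 3 ≤ G.degree v) :
    ∃ w : Fin 3 → V, Function.Injective w ∧ ∀ i, G.Adj v (w i) := by
  obtain ⟨e⟩ : Nonempty (Fin 3 ↪ G.neighborSet v) :=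
    Function.Embedding.nonempty_of_card_le (by rwa [Fintype.card_fin, G.card_neighborSet_eq_degree])
  exact ⟨fun i => e i, fun i k h => e.injective (Subtype.ext h), fun i => (e i).2⟩

/-- Edges at a common vertex of the realization meet only in that vertex. -/
lemma SimpleGraph.realization.edgePath_eq {V : Type*} [Fintype V] [DecidableEq V]
    {G : SimpleGraph V} {v a b : V} (ha : G.Adj v a) (hb : G.Adj v b) (hab : a ≠ b) {s t : I}
    (h : edgePath ha s = edgePath hb t) : t = 0 := by
  have := congrFun (congrArg Subtype.val h) b
  simp [edgePath, Pi.single_eq_of_ne hb.ne', Pi.single_eq_of_ne hab.symm] at this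
  exact Subtype.ext this.symm

namespace PathCocycle

variable {X Y : Type*} [TopologicalSpace X] [TopologicalSpace Y] {A : Type*} [AddCommGroup A]

lemma IsExact.of_comap {φ : PathCocycle Y A} {f : C(X, Y)} (h : (φ.comap f).IsExact) (g : C(Y, X))
    (hfg : ∀ y, f (g y) = y) : φ.IsExact := by
  obtain ⟨u, hu⟩ := h.comap g
  refine ⟨u, fun p => ?_⟩
  rw [← hu p]
  exact congrArg φ (ContinuousMap.ext fun t => (hfg _).symm)

lemma IsExact.of_sub {φ ψ : PathCocycle X A} (h : (φ - ψ).IsExact) (hψ : ψ.IsExact) :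
    φ.IsExact := by
  obtain ⟨u, hu⟩ := h.add hψ
  exact ⟨u, fun p => by rw [← hu p]; simp⟩

lemma IsExact.comap_sub {φ ψ : PathCocycle Y A} (h : (φ - ψ).IsExact) (f : C(X, Y)) :
    (φ.comap f - ψ.comap f).IsExact := h.comap f

lemma IsExact.of_sub' {φ ψ : PathCocycle X A} (h : (φ - ψ).IsExact) (hφ : φ.IsExact) :
    ψ.IsExact := by
  obtain ⟨u, hu⟩ := hφ.sub h
  exact ⟨u, fun p => by rw [← hu p]; simp⟩

end PathCocycle

/-- The Euclidean plane as the complex plane. -/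
noncomputable def planeHomeomorph : EuclideanSpace ℝ (Fin 2) ≃ₜ ℂ :=
  Complex.orthonormalBasisOneI.repr.symm.toHomeomorph

namespace Conf2

/-- The plane configurations of complex configurations. -/
noncomputable def ofComplex : C(Conf2 ℂ, Conf2 (EuclideanSpace ℝ (Fin 2))) :=
  map planeHomeomorph.symm planeHomeomorph.symm.injective

/-- The complex configurations of plane configurations. -/
noncomputable def toComplex : C(Conf2 (EuclideanSpace ℝ (Fin 2)), Conf2 ℂ) :=
  map planeHomeomorph planeHomeomorph.injective

lemma ofComplex_toComplex (z : Conf2 (EuclideanSpace ℝ (Fin 2))) : ofComplex (toComplex z) = z :=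
  Subtype.ext (Prod.ext (planeHomeomorph.symm_apply_apply _) (planeHomeomorph.symm_apply_apply _))

instance : PathConnectedSpace (Conf2 (EuclideanSpace ℝ (Fin 2))) :=
  Function.Surjective.pathConnectedSpace (fun z => ⟨_, ofComplex_toComplex z⟩) ofComplex.continuous

end Conf2

section

variable {V : Type*} [Fintype V] {G : SimpleGraph V} [DecidableRel G.Adj]
  {Γ : Set (EuclideanSpace ℝ (Fin 2))} {A : Type*} [AddCommGroup A]

/-- An embedded planar graph with an essential vertex contains a triod that is properly embedded
in a disc. -/
lemma exists_planar_triod (h : G.realization ≃ₜ Γ) {v : V} (hv : 3 ≤ G.degree v) :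
    ∃ (α : Fin 3 → C(I, Γ)) (x : Γ) (o : ℂ) (r : ℝ), (∀ i, α i 0 = x) ∧
      Conf2.IsDiscTriod (fun i => ⟨fun t => planeHomeomorph (α i t), by fun_prop⟩) o r := by
  classical
  obtain ⟨w, hw, hadj⟩ := G.exists_three_neighbors hv
  let F : Fin 3 → C(I, Γ) := fun i =>
    (h : C(G.realization, Γ)).comp (SimpleGraph.realization.edgePath (hadj i))
  let f : Fin 3 → C(I, ℂ) := fun i => ⟨fun t => planeHomeomorph (F i t), by fun_prop⟩
  have hinj : ∀ {y z : G.realization}, planeHomeomorph (h y) = planeHomeomorph (h z) → y = z :=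
    fun e => h.injective (Subtype.ext (planeHomeomorph.injective e))
  have h0 : ∀ i, F i 0 = h (SimpleGraph.realization.vertex G v) := fun i =>
    congrArg h (SimpleGraph.realization.edgePath_zero _)
  obtain ⟨τ, r, hT⟩ := Conf2.exists_isDiscTriod f
    (planeHomeomorph (h (SimpleGraph.realization.vertex G v)))
    (fun i => congrArg (fun y : Γ => planeHomeomorph y) (h0 i))
    (fun i e => by
      have := hinj e
      rw [SimpleGraph.realization.edgePath_one] at this
      have := congrFun (congrArg Subtype.val this) v
      simp [SimpleGraph.realization.vertex, Pi.single_eq_of_ne (hadj i).ne] at this)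
    (fun i k s t hik e =>
      SimpleGraph.realization.edgePath_eq (hadj i) (hadj k) (hw.ne hik) (hinj e))
  refine ⟨fun i => Conf2.initial (F i) (τ i), h (SimpleGraph.realization.vertex G v), _, r,
    fun i => ?_, hT⟩
  simp [Conf2.initial, h0]

/-- The restriction to paths of distinct points of a sum of path cocycles on the factors of
`F(ℝ², 2) × Γ × Γ` is exact only if each of them is. -/
theorem isExact_of_sum_isExact (h : G.realization ≃ₜ Γ) (hG : G.Connected)
    (hess : ∃ v, 3 ≤ G.degree v) (φ₁ : PathCocycle (Conf2 (EuclideanSpace ℝ (Fin 2))) A)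
    (φ₂ φ₃ : PathCocycle Γ A)
    (hsum : ((φ₁.comap ContinuousMap.fst + (φ₂.comap ContinuousMap.fst +
      φ₃.comap ContinuousMap.snd).comap ContinuousMap.snd).comap (confBeta Γ)).IsExact) :
    φ₁.IsExact ∧ φ₂.IsExact ∧ φ₃.IsExact := by
  classical
  obtain ⟨v, hv⟩ := hsum
  let θ : C(Conf2 Γ, Conf2 (EuclideanSpace ℝ (Fin 2))) := ContinuousMap.fst.comp (confBeta Γ)
  have hv' : ∀ (x y : C(I, Γ)) (hxy : ∀ t, x t ≠ y t),
      φ₁ (θ.comp (Conf2.path x y hxy)) + (φ₂ x + φ₃ y) =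
        v ⟨(x 1, y 1), hxy 1⟩ - v ⟨(x 0, y 0), hxy 0⟩ := fun x y hxy => hv (Conf2.path x y hxy)
  have h₁ : φ₁.IsExact := by
    obtain ⟨b, hb⟩ := hess
    obtain ⟨α, o', o, r, hα, hT⟩ := exists_planar_triod h hb
    -- The value on the diagonal is a dummy: all the pairs that matter below are distinct.
    let vv : Γ → Γ → A := fun x y => if hxy : x ≠ y then v ⟨(x, y), hxy⟩ else 0
    have hvv : ∀ (x y : C(I, Γ)) (hxy : ∀ t, x t ≠ y t),
        φ₁ (θ.comp (Conf2.path x y hxy)) + (φ₂ x + φ₃ y) =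
          vv (x 1) (y 1) - vv (x 0) (y 0) := fun x y hxy => by
      simp only [vv, dif_pos (hxy _)]
      exact hv' x y hxy
    have hne : ∀ {i k} t, i ≠ k → α i t ≠ α k 1 := fun t hik e =>
      hT.ne _ _ t hik (congrArg (fun y : Γ => planeHomeomorph y) e)
    refine PathCocycle.IsExact.of_comap (f := Conf2.ofComplex) ?_ Conf2.toComplex
      Conf2.ofComplex_toComplex
    refine hT.isExact _ (fun i => φ₂ (α i)) (fun i => φ₃ (α i)) (fun k => vv o' (α k 1))
      (fun k => vv (α k 1) o') (fun i k => vv (α i 1) (α k 1)) (fun i k hik => ?_)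
      (fun i k hik => ?_)
    · have key := hvv (α i) (ContinuousMap.const I (α k 1)) fun t => hne t hik
      rw [φ₃.apply_const, add_zero] at key
      simp only [ContinuousMap.const_apply, hα] at key
      have eq : Conf2.ofComplex.comp (hT.moveLeft hik) = θ.comp
          (Conf2.path (α i) (ContinuousMap.const I (α k 1)) fun t => hne t hik) :=
        ContinuousMap.ext fun t => Subtype.ext (Prod.ext
          (planeHomeomorph.symm_apply_apply _) (planeHomeomorph.symm_apply_apply _))
      rw [PathCocycle.comap_apply, eq]
      exact key
    · have key := hvv (ContinuousMap.const I (α k 1)) (α i) fun t => (hne t hik).symm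
      rw [φ₂.apply_const, zero_add] at key
      simp only [ContinuousMap.const_apply, hα] at key
      have eq : Conf2.ofComplex.comp (hT.moveRight hik) = θ.comp
          (Conf2.path (ContinuousMap.const I (α k 1)) (α i) fun t => (hne t hik).symm) :=
        ContinuousMap.ext fun t => Subtype.ext (Prod.ext
          (planeHomeomorph.symm_apply_apply _) (planeHomeomorph.symm_apply_apply _))
      rw [PathCocycle.comap_apply, eq]
      exact key
  refine ⟨h₁, ?_⟩
  obtain ⟨u, hu⟩ := h₁
  -- Exactness off every point is transported to the realization; it is obtained for φ₂ and φ₃ by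
  -- holding the other point at `y` and subtracting the potential of φ₁.
  have graph : ∀ φ : PathCocycle Γ A, (∀ y, ∃ u : Γ → A, ∀ p : C(I, Γ), (∀ t, p t ≠ y) →
      φ p = u (p 1) - u (p 0)) → φ.IsExact := fun φ hφ => by
    refine PathCocycle.IsExact.of_comap (f := (h : C(G.realization, Γ))) ?_
      (h.symm : C(Γ, G.realization)) h.apply_symm_apply
    refine SimpleGraph.realization.isExact_of_forall_point hG hess _ fun y => ?_
    obtain ⟨u, hu⟩ := hφ (h y)
    exact ⟨fun x => u (h x), fun p hp => hu _ fun t e => hp t (h.injective e)⟩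
  constructor
  · refine graph φ₂ fun y => ⟨fun x => if hxy : x ≠ y then
      v ⟨(x, y), hxy⟩ - u (θ ⟨(x, y), hxy⟩) else 0, fun p hp => ?_⟩
    have key := hv' p (ContinuousMap.const I y) hp
    rw [φ₃.apply_const, add_zero, hu] at key
    beta_reduce
    rw [dif_pos (hp 1), dif_pos (hp 0), eq_sub_of_add_eq' key]
    change _ - (u (θ ⟨(p 1, y), hp 1⟩) - u (θ ⟨(p 0, y), hp 0⟩)) = _
    simp only [ContinuousMap.const_apply]
    abel
  · refine graph φ₃ fun y => ⟨fun x => if hxy : y ≠ x then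
      v ⟨(y, x), hxy⟩ - u (θ ⟨(y, x), hxy⟩) else 0, fun p hp => ?_⟩
    have key := hv' (ContinuousMap.const I y) p fun t => (hp t).symm
    rw [φ₂.apply_const, zero_add, hu] at key
    beta_reduce
    rw [dif_pos (hp 1).symm, dif_pos (hp 0).symm, eq_sub_of_add_eq' key]
    change _ - (u (θ ⟨(y, p 1), (hp 1).symm⟩) - u (θ ⟨(y, p 0), (hp 0).symm⟩)) = _
    simp only [ContinuousMap.const_apply]
    abel

theorem isExact_of_comap_confBeta (h : G.realization ≃ₜ Γ) (hG : G.Connected)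
    (hess : ∃ v, 3 ≤ G.degree v)
    (φ : PathCocycle (Conf2 (EuclideanSpace ℝ (Fin 2)) × Γ × Γ) A)
    (hφ : (φ.comap (confBeta Γ)).IsExact) : φ.IsExact := by
  have := SimpleGraph.realization.pathConnectedSpace hG
  have : PathConnectedSpace Γ := h.surjective.pathConnectedSpace h.continuous
  obtain ⟨x₀⟩ := PathConnectedSpace.nonempty (X := Γ)
  obtain ⟨z₀⟩ := PathConnectedSpace.nonempty (X := Conf2 (EuclideanSpace ℝ (Fin 2)))
  have e₁ := φ.sub_slices_isExact z₀ (x₀, x₀)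
  have e₂ := (φ.sliceRight z₀).sub_slices_isExact x₀ x₀
  set φ₁ := φ.sliceLeft (x₀, x₀)
  set φ₂ := (φ.sliceRight z₀).sliceLeft x₀
  set φ₃ := (φ.sliceRight z₀).sliceRight x₀
  have e : (φ - (φ₁.comap ContinuousMap.fst + (φ₂.comap ContinuousMap.fst +
      φ₃.comap ContinuousMap.snd).comap ContinuousMap.snd)).IsExact := by
    obtain ⟨u, hu⟩ := e₁.add (e₂.comap ContinuousMap.snd)
    refine ⟨u, fun p => ?_⟩
    rw [← hu p]
    simp only [PathCocycle.add_apply, PathCocycle.sub_apply, PathCocycle.comap_apply]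
    abel
  obtain ⟨h₁, h₂, h₃⟩ := isExact_of_sum_isExact h hG hess φ₁ φ₂ φ₃
    (PathCocycle.IsExact.of_sub' (φ := φ.comap (confBeta Γ)) (e.comap_sub (confBeta Γ)) hφ)
  exact e.of_sub ((h₁.comap _).add (((h₂.comap _).add (h₃.comap _)).comap _))

end

theorem corollary7p2 {V : Type*} [Fintype V] (G : SimpleGraph V) [DecidableRel G.Adj]
    (Γ : Set (EuclideanSpace ℝ (Fin 2))) (hΓ : Nonempty (G.realization ≃ₜ Γ))
    (hconn : G.Connected) (hess : ∃ v, 3 ≤ G.degree v) :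
    Function.Surjective (singularHMap 1 (confBeta Γ)) ∧
      Function.Injective (singularCohMap 1 (confBeta Γ)) := by
  obtain ⟨h⟩ := hΓ
  exact PathCocycle.surjective_and_injective_of_isExact _
    fun A _ φ hφ => isExact_of_comap_confBeta h hconn hess φ hφ
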